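/- Write $\{0,1\}^n_*=\{0,1\}^n\setminus\{1^n\}$, let $h(v)$ be the number of $1$'s of $v\in\{0,1\}^n$, and let $e_{i,b}:\{0,1\}^{n}\to\{0,1\}^{n+1}$ insert the value $b$ at coordinate $i$. A map $\phi:\{0,1\}^n\to\{0,1\}^m$ is a $\mathcal G$-morphism if each coordinate $\phi(v)_i$ is constant, or equal to $v_j$ or to $1-v_j$ for some $j=j(i)$, and $j(i)\le j(i')$ whenever $i<i'$ and both coordinates are non-constant. A *groupspace* is a set $X$ with sets $C^n(X)\subseteq X^{\{0,1\}^n}$ ($n\ge 0$) such that (presheaf) $c\circ\phi\in C^n(X)$ for $c\in C^m(X)$ and every $\mathcal G$-morphism $\phi:\{0,1\}^n\to\{0,1\}^m$; (ergodicity) $C^1(X)=X^{\{0,1\}}$; (completion) every $f:\{0,1\}^n_*\to X$ with $f\circ e_{i,0}\in C^{n-1}(X)$ for all $i$ extends to an element of $C^n(X)$. It is *$k$-step* if two elements of $C^{k+1}(X)$ that agree on $\{0,1\}^{k+1}_*$ are equal, and *$k$-ergodic* if $C^k(X)=X^{\{0,1\}^k}$. An isomorphism is a bijection that preserves cubes in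 both directions. Write $x\sim_i y$ if there are $c_1,c_2\in C^{i+1}(X)$ that agree on $\{0,1\}^{i+1}_*$ with $c_1(1^{i+1})=x$, $c_2(1^{i+1})=y$; let $X_i=X/\!\sim_i$, with the images of the cubes of $X$ as cubes, and let $\pi_{i,j}:X_i\to X_j$ ($j\le i$) be the natural maps. A *fiber* of a $k$-step groupspace is a $\sim_{k-1}$-class with the cubes of $X$ that take values in it. For $c_1,c_2\in C^n(X)$ write $c_1\approx_1c_2$ if $c_1=c\circ e_{1,0}$ and $c_2=c\circ e_{1,1}$ for some $c\in C^{n+1}(X)$. For a group $G$, $\mathcal D_1(G)$ is $G$ with the cubes $v\mapsto a_0a_1^{v_1}\cdots a_n^{v_n}$. For an abelian group $A$ and $k\ge1$, $\mathcal D_k(A)$ is $A$ with cubes the maps $f:\{0,1\}^n\to A$ with $\sum_{u\in\{0,1\}^{h(v)}}(-1)^{h(u)}f(s_v(u))=0$ for every $v\in\{0,1\}^n$ with $h(v)\ge k+1$, where $s_v:\{0,1\}^{h(v)}\to\{0,1\}^n$ puts its argument, in order, on the support of $v$ and $0$ elsewhere. **Theorem.** Let $X$ be a groupspace. 1. Let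 $k\ge 2$ and suppose that $X$ is $k$-step. Then $\sim_{k-1}$ is an equivalence relation, every fiber of $X$ is a $k$-step, $k$-ergodic groupspace, any two fibers of $X$ are isomorphic, and there is one abelian group $A$ such that every fiber is isomorphic to $\mathcal D_k(A)$. 2. For every $i\ge 0$, $\sim_i$ is an equivalence relation and $X_i$ is an $i$-step groupspace. It is the largest such factor: if $\sim$ is an equivalence relation on $X$ such that $X/\!\sim$, with the images of the cubes of $X$ as cubes, is an $i$-step groupspace, then $x\sim_i y$ implies $x\sim y$. The space $X_0$ is a single point, and if $X$ is $k$-step then the quotient map $X\to X_k$ is an isomorphism. 3. (First structure group.) There is a group $G_1$, unique up to isomorphism, with an isomorphism $X_1\cong\mathcal D_1(G_1)$. The left and the right multiplication of $G_1$, carried over to $X_1$ by this isomorphism, are actions by groupspace automorphisms, and each makes $X_1\to X_0$ a principal bundle (the action is free and its orbits are the fibers of the map, which is onto). 4. ($k$-th structure group, $k\ge2$.) For every $k\ge 2$ there is an abelian group $G_k$, unique up to isomorphism, such that every fiber of the $k$-step groupspace $X_k$ is isomorphic to $\mathcal D_k(G_k)$. Moreover there is an action of $G_k$ on $X_k$ by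 groupspace automorphisms, $(x,a)\mapsto x^a$, for which $\pi_{k,k-1}:X_k\to X_{k-1}$ is a principal $G_k$-bundle: the map is onto, the action is free, and its orbits are the fibers of $\pi_{k,k-1}$, which are the $\sim_{k-1}$-classes of $X_k$. On each fiber $F$ the action is translation: there is an isomorphism $e:F\to\mathcal D_k(G_k)$ such that $y=x^a$ if and only if $e(y)=e(x)+a$, for $x,y\in F$ and $a\in G_k$. The actions on the different fibers are matched by $\approx_1$: for all $x,y\in X_k$ and $a\in G_k$ we have $q_{x,a}\approx_1 q_{y,a}$, where $q_{x,a}:\{0,1\}^k\to X_k$ takes the value $x^a$ at $0^k$ and $x$ at all other vertices. -/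

import Mathlib

universe u v

/-! ### Discrete cubes and their morphisms -/

/-- The discrete cube `{0,1}^n`. -/
abbrev DCube (n : ℕ) : Type := Fin n → Bool

namespace DCube

/-- The vertex `1^n`. -/
def ones (n : ℕ) : DCube n := fun _ => true

/-- The vertex `0^n`. -/
def zeros (n : ℕ) : DCube n := fun _ => false

/-- The support of a vertex. -/
def supp {n : ℕ} (v : DCube n) : Finset (Fin n) := Finset.univ.filter fun i => v i = true

/-- The height `h(v)`: the number of coordinates equal to `1`. -/
abbrev height {n : ℕ} (v : DCube n) : ℕ := (supp v).card

/-- The `i`-th coordinate of `φ` is the `j`-th coordinate function or its negation. -/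
def IsCoord {n m : ℕ} (φ : DCube n → DCube m) (i : Fin m) (j : Fin n) : Prop :=
  (∀ v, φ v i = v j) ∨ (∀ v, φ v i = !(v j))

/-- Morphisms of the category `𝒩`: every coordinate of `φ` is constant, or is a coordinate
function, or is the negation of a coordinate function. -/
def IsNMorphism {n m : ℕ} (φ : DCube n → DCube m) : Prop :=
  ∀ i, (∃ b : Bool, ∀ v, φ v i = b) ∨ ∃ j, IsCoord φ i j

/-- Morphisms of the category `𝒢`: morphisms of `𝒩` such that the index of the coordinate on
which `φ(v)_i` depends is a monotone function of `i` (over the nonconstant coordinates). -/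
def IsGMorphism {n m : ℕ} (φ : DCube n → DCube m) : Prop :=
  IsNMorphism φ ∧
    ∀ i i' : Fin m, i < i' → ∀ j j' : Fin n, IsCoord φ i j → IsCoord φ i' j' → j ≤ j'

/-- The face embedding `e_{i,b} : {0,1}^n → {0,1}^{n+1}` inserting the value `b` at place `i`. -/
def face {n : ℕ} (i : Fin (n + 1)) (b : Bool) (v : DCube n) : DCube (n + 1) :=
  Fin.insertNth (α := fun _ => Bool) i b v

/-- The simplicial embedding `s_v : {0,1}^{h(v)} → {0,1}^n`: it places its argument on the support
of `v`, in increasing order, and `0` elsewhere. -/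
def simplicialEmb {n : ℕ} (v : DCube n) (x : DCube (height v)) : DCube n := fun i =>
  if hi : i ∈ supp v then x (((supp v).orderIsoOfFin rfl).symm ⟨i, hi⟩) else false

/-- The punctured cube `{0,1}^n_* = {0,1}^n ∖ {1^n}`. -/
abbrev Punctured (n : ℕ) : Type := {v : DCube n // v ≠ ones n}

theorem face_false_ne_ones {n : ℕ} (i : Fin (n + 1)) (v : DCube n) :
    face i false v ≠ ones (n + 1) := by
  intro h
  have := congrFun h i
  simp [face, ones] at this

/-- The face embedding `e_{i,0}`, as a map into the punctured cube. -/
def puncturedFace {n : ℕ} (i : Fin (n + 1)) (v : DCube n) : Punctured (n + 1) :=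
  ⟨face i false v, face_false_ne_ones i v⟩

/-- The alternating sum `w(f) = ∑_v (-1)^{h(v)} f(v)`. -/
def altSum {n : ℕ} {A : Type*} [AddCommGroup A] (f : DCube n → A) : A :=
  ∑ v : DCube n, ((-1 : ℤ) ^ height v) • f v

/-- The map taking the value `y` at `0^n` and the value `x` at every other vertex. -/
def spike {X : Type*} (n : ℕ) (x y : X) : DCube n → X := fun v => if v = zeros n then y else x

end DCube

open DCube in
/-- The map `{0,1}^{n} → {0,1}^{n+1}` appending a coordinate `1` is a morphism of `𝒢`. -/
theorem DCube.isGMorphism_snoc_true (n : ℕ) :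
    IsGMorphism (fun x : DCube n => (Fin.snoc (α := fun _ => Bool) x true : DCube (n + 1))) := by
  have key : ∀ (i : Fin n) (j : Fin n),
      IsCoord (fun x : DCube n => (Fin.snoc (α := fun _ => Bool) x true : DCube (n + 1)))
        i.castSucc j → i = j := by
    intro i j h
    by_contra hne
    rcases h with h | h
    · have h1 := h (Function.update (zeros n) j true)
      simp [zeros, Function.update_of_ne hne] at h1
    · have h1 := h (zeros n)
      simp [zeros] at h1
  have last : ∀ j : Fin n,
      ¬ IsCoord (fun x : DCube n => (Fin.snoc (α := fun _ => Bool) x true : DCube (n + 1)))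
        (Fin.last n) j := by
    intro j h
    rcases h with h | h
    · have h1 := h (zeros n)
      simp [zeros] at h1
    · have h1 := h (ones n)
      simp [ones] at h1
  constructor
  · intro i
    refine Fin.lastCases ?_ (fun i => ?_) i
    · exact Or.inl ⟨true, fun v => by simp⟩
    · exact Or.inr ⟨i, Or.inl fun v => by simp⟩
  · intro i i' hii' j j' hj hj'
    induction i' using Fin.lastCases with
    | last => exact absurd hj' (last j')
    | cast i' =>
      induction i using Fin.lastCases with
      | last => exact absurd hj (last j)
      | cast i =>
        rw [← key i j hj, ← key i' j' hj']
        exact le_of_lt (by simpa using hii')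

/-! ### Cube structures and groupspaces -/

/-- A cube structure on `X`: for every `n` a set `C^n(X)` of maps `{0,1}^n → X`. -/
structure CubeStructure (X : Type u) where
  cubes : (n : ℕ) → Set (DCube n → X)

namespace CubeStructure

open DCube

variable {X : Type u} {Y : Type v}

/-- The hypothesis of the completion axiom on a map `f : {0,1}^n_* → X`: all `f ∘ e_{i,0}` are
cubes (no condition if `n = 0`). -/
def IsCorner (C : CubeStructure X) : {n : ℕ} → (Punctured n → X) → Prop
  | 0, _ => True
  | n + 1, f => ∀ i : Fin (n + 1), f ∘ puncturedFace i ∈ C.cubes n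

/-- Groupspaces. -/
structure IsGroupspace (C : CubeStructure X) : Prop where
  presheaf : ∀ (n m : ℕ) (φ : DCube n → DCube m), IsGMorphism φ →
    ∀ c ∈ C.cubes m, c ∘ φ ∈ C.cubes n
  ergodicity : C.cubes 1 = Set.univ
  completion : ∀ (n : ℕ) (f : Punctured n → X), C.IsCorner f →
    ∃ c ∈ C.cubes n, ∀ v : Punctured n, c v = f v

/-- Uniqueness of completion in dimension `k + 1`; a `k`-step groupspace is a groupspace with this
property. -/
def IsStep (C : CubeStructure X) (k : ℕ) : Prop :=
  ∀ c ∈ C.cubes (k + 1), ∀ c' ∈ C.cubes (k + 1),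
    (∀ v : Punctured (k + 1), c v = c' v) → c = c'

/-- `k`-ergodicity: all maps `{0,1}^k → X` are cubes. -/
def IsErgodic (C : CubeStructure X) (k : ℕ) : Prop := C.cubes k = Set.univ

/-- Morphisms of cube structures. -/
def IsMorphism (C : CubeStructure X) (D : CubeStructure Y) (f : X → Y) : Prop :=
  ∀ (n : ℕ), ∀ c ∈ C.cubes n, f ∘ c ∈ D.cubes n

/-- A bijection that is a morphism in both directions. -/
def IsIsomorphism (C : CubeStructure X) (D : CubeStructure Y) (e : X ≃ Y) : Prop :=
  IsMorphism C D e ∧ IsMorphism D C e.symm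

/-- Isomorphic cube structures. -/
def Isomorphic (C : CubeStructure X) (D : CubeStructure Y) : Prop :=
  ∃ e : X ≃ Y, IsIsomorphism C D e

/-- The push-forward cube structure along `m : X → Y`. -/
def pushforward (C : CubeStructure X) (m : X → Y) : CubeStructure Y where
  cubes n := {d | ∃ c ∈ C.cubes n, d = m ∘ c}

/-- The cube structure inherited by a subset. -/
def restrict (C : CubeStructure X) (S : Set X) : CubeStructure S where
  cubes n := {c | (fun v => (c v : X)) ∈ C.cubes n}

/-- The relation `c₁ ≈_i c₂` on `n`-dimensional cubes: they are the two opposite faces, in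
direction `i`, of an `(n+1)`-dimensional cube. -/
def FaceEquiv (C : CubeStructure X) {n : ℕ} (i : Fin (n + 1)) (c₁ c₂ : DCube n → X) : Prop :=
  ∃ c₃ ∈ C.cubes (n + 1), c₁ = c₃ ∘ face i false ∧ c₂ = c₃ ∘ face i true

/-- The relation `x ∼_i y`. -/
def Sim (C : CubeStructure X) (i : ℕ) (x y : X) : Prop :=
  ∃ c₁ ∈ C.cubes (i + 1), ∃ c₂ ∈ C.cubes (i + 1),
    c₁ (ones (i + 1)) = x ∧ c₂ (ones (i + 1)) = y ∧ ∀ v : Punctured (i + 1), c₁ v = c₂ v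

/-- The quotient `X_i = X / ∼_i`. -/
def Factor (C : CubeStructure X) (i : ℕ) : Type u := Quot (C.Sim i)

/-- The factor map `π_i : X → X_i`. -/
def proj (C : CubeStructure X) (i : ℕ) : X → C.Factor i := Quot.mk (C.Sim i)

/-- The cube structure of `X_i`, pushed forward from `X`. -/
def factor (C : CubeStructure X) (i : ℕ) : CubeStructure (C.Factor i) :=
  C.pushforward (C.proj i)

/-- The `∼_i`-class of `x`. -/
def simClass (C : CubeStructure X) (i : ℕ) (x : X) : Set X := {y | C.Sim i y x}

/-- For a `k`-step groupspace (`k ≥ 1`), the fiber through `x`: the `∼_{k-1}`-class of `x` with the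
inherited cubes. -/
def fiber (C : CubeStructure X) (k : ℕ) (x : X) : CubeStructure (C.simClass (k - 1) x) :=
  C.restrict (C.simClass (k - 1) x)

theorem IsGroupspace.sim_of_sim_succ {C : CubeStructure X} (hC : C.IsGroupspace) {i : ℕ} {x y : X}
    (h : C.Sim (i + 1) x y) : C.Sim i x y := by
  obtain ⟨c₁, h₁, c₂, h₂, hx, hy, hv⟩ := h
  have hones : (Fin.snoc (α := fun _ => Bool) (ones (i + 1)) true : DCube (i + 2))
      = ones (i + 2) := by
    funext j
    refine Fin.lastCases ?_ (fun j => ?_) j <;> simp [ones]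
  refine ⟨_, hC.presheaf _ _ _ (isGMorphism_snoc_true (i + 1)) c₁ h₁,
    _, hC.presheaf _ _ _ (isGMorphism_snoc_true (i + 1)) c₂ h₂, ?_, ?_, ?_⟩
  · simp only [Function.comp, hones, hx]
  · simp only [Function.comp, hones, hy]
  · intro v
    refine hv ⟨(Fin.snoc (α := fun _ => Bool) (v : DCube (i + 1)) true : DCube (i + 2)),
      fun hw => v.2 ?_⟩
    funext j
    have h1 := congrFun hw j.castSucc
    simpa [ones] using h1

theorem IsGroupspace.sim_of_le {C : CubeStructure X} (hC : C.IsGroupspace) {j i : ℕ} (hji : j ≤ i)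
    {x y : X} (h : C.Sim i x y) : C.Sim j x y := by
  induction i, hji using Nat.le_induction with
  | base => exact h
  | succ i _ ih => exact ih (hC.sim_of_sim_succ h)

/-- The factor map `π_{i,j} : X_i → X_j` for `j ≤ i`, induced by the identity of `X`. -/
def IsGroupspace.factorMap {C : CubeStructure X} (hC : C.IsGroupspace) (i j : ℕ) (hji : j ≤ i) :
    C.Factor i → C.Factor j :=
  Quot.map id fun _ _ h => hC.sim_of_le hji h

/-- The cube structure `𝒟₁(G)` of a (possibly non-commutative) group: the cubes are the maps
`v ↦ a₀ a₁^{v₁} a₂^{v₂} ⋯ a_n^{v_n}`. -/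
def groupCubes (G : Type u) [Group G] : CubeStructure G where
  cubes n := {c | ∃ (a₀ : G) (a : Fin n → G),
    ∀ v, c v = a₀ * (List.ofFn fun i => if v i = true then a i else 1).prod}

/-- The cube structure `𝒟_k(A)` of an abelian group: `f : {0,1}^n → A` is a cube if
`w(f ∘ s_v) = 0` for all `v` of height at least `k + 1`. -/
def abelianCubes (k : ℕ) (A : Type u) [AddCommGroup A] : CubeStructure A where
  cubes n := {f | ∀ v : DCube n, k + 1 ≤ height v → altSum (f ∘ simplicialEmb v) = 0}

end CubeStructure

/-- A map `π : E → B` is a principal `G`-bundle (of sets) for a given action of `G` on `E`: it is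
onto, the action is free, and the orbits are exactly the fibers of `π`. -/
structure IsPrincipalBundle (G : Type*) {E B : Type*} [Group G] [MulAction G E] (π : E → B) :
    Prop where
  surjective : Function.Surjective π
  free : ∀ (g : G) (p : E), g • p = p → g = 1
  orbits : ∀ p q : E, π p = π q ↔ ∃ g : G, g • p = q

/-! ### Morphisms of `𝒢`, face embeddings and reflections -/

namespace DCube

/-! Completion fills more than corners: by `exists_extension`, a map that is a cube below every
vertex of a lower set extends from that set to a cube. Used in `{0,1}^{2n}`, with neighbouring
coordinates for `v_i` and `1 - v_i`, this gives the gluing `tricube` and then `glue`, which replaces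
the values of a cube on a face. All modifications of cubes rest on these.

Hence `x ∼_i y` exactly when the constant `(i+1)`-cube `x` may be changed to `y` at the vertex
`1^{i+1}` (`sim_iff`). So membership in the cubes of dimension at most `i+1` depends only on the
`∼_i`-classes of the values (`mem_of_sim`). This makes `X_i` a groupspace: low-dimensional data lift
arbitrarily, and higher vertices are forced by uniqueness.

For the structure groups, let `X` be `(k+1)`-step and `x ∼_k y`. For each `z` exactly one `w` makes
`edgeMap j x y z w` a `(k+2)`-cube, and `z ↦ w` is a permutation that may be applied to both ends of
any `j`-edge of a `(k+2)`-cube. These permutations form `edgeGroup j`, which is free and transitive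
on every `∼_k`-class. Different directions commute (`commute_edgeGroup`): apply both to a constant
cube at edges meeting in the top vertex.

In the 1-step case there are two directions, hence two commuting regular actions: left and right
multiplication of one group. With at least three directions, a third one shows that any two act
alike on a class (`exists_edgeGroup_apply_eq`), so the group is abelian. Pushing values along edges
to the top vertex then shows that the `(k+2)`-cubes in a class are those of alternating sum zero
(`mem_iff_altSum`). -/

theorem ones_eq_top (n : ℕ) : ones n = ⊤ := rfl

theorem IsCoord.eq {n m : ℕ} {φ : DCube n → DCube m} {i : Fin m} {j j' : Fin n}
    (h : IsCoord φ i j) (h' : IsCoord φ i j') : j = j' := by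
  by_contra hne
  have hne' : j' ≠ j := fun h => hne h.symm
  rcases h with h | h <;> rcases h' with h' | h' <;>
  · have h1 := h (Function.update (zeros n) j true)
    have h2 := h' (Function.update (zeros n) j true)
    have h3 := h (zeros n)
    have h4 := h' (zeros n)
    simp [zeros, hne'] at h1 h2 h3 h4
    simp_all

theorem IsCoord.not_const {n m : ℕ} {φ : DCube n → DCube m} {i : Fin m} {j : Fin n}
    (h : IsCoord φ i j) {b : Bool} (hb : ∀ v, φ v i = b) : False := by
  rcases h with h | h <;>
  · have h1 := h (zeros n)
    have h2 := h (ones n)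
    rw [hb] at h1 h2
    simp [zeros, ones] at h1 h2
    simp_all

/-- A map is a morphism of `𝒢` if the dependency of its coordinates is contained in a monotone
relation. -/
theorem isGMorphism_of_rel {n m : ℕ} {φ : DCube n → DCube m} (r : Fin m → Fin n → Prop)
    (hr : ∀ i i' j j', i < i' → r i j → r i' j' → j ≤ j')
    (h : ∀ i, (∃ b : Bool, ∀ v, φ v i = b) ∨ ∃ j, r i j ∧ IsCoord φ i j) : IsGMorphism φ := by
  refine ⟨fun i => (h i).imp_right fun ⟨j, hj⟩ => ⟨j, hj.2⟩, fun i i' hi j j' hj hj' => ?_⟩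
  rcases h i with ⟨b, hb⟩ | ⟨l, hl, hl'⟩
  · exact (hj.not_const hb).elim
  rcases h i' with ⟨b, hb⟩ | ⟨l', hr', hl''⟩
  · exact (hj'.not_const hb).elim
  rw [hj.eq hl', hj'.eq hl'']
  exact hr i i' l l' hi hl hr'

/-- Maps whose `i`-th coordinate depends on the `i`-th coordinate only. -/
theorem isGMorphism_of_diag {n : ℕ} {φ : DCube n → DCube n}
    (h : ∀ i, (∃ b : Bool, ∀ v, φ v i = b) ∨ IsCoord φ i i) : IsGMorphism φ :=
  isGMorphism_of_rel (fun i j => i = j) (by rintro i i' _ _ h rfl rfl; exact h.le)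
    fun i => (h i).imp_right fun h => ⟨i, rfl, h⟩

theorem isGMorphism_of_coord {n : ℕ} {φ : DCube n → DCube n} (g : Fin n → Bool → Bool)
    (h : ∀ v i, φ v i = g i (v i)) : IsGMorphism φ := by
  refine isGMorphism_of_diag fun i => ?_
  have h1 : ∀ f : Bool → Bool, (∃ b, ∀ x, f x = b) ∨ (∀ x, f x = x) ∨ ∀ x, f x = !x := by decide
  rcases h1 (g i) with ⟨b, hb⟩ | hb | hb
  · exact Or.inl ⟨b, fun v => by rw [h, hb]⟩
  · exact Or.inr (Or.inl fun v => by rw [h, hb])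
  · exact Or.inr (Or.inr fun v => by rw [h, hb])

theorem IsGMorphism.comp {n m l : ℕ} {φ : DCube m → DCube l} {ψ : DCube n → DCube m}
    (hφ : IsGMorphism φ) (hψ : IsGMorphism ψ) : IsGMorphism (φ ∘ ψ) := by
  refine isGMorphism_of_rel (fun i j => ∃ p, IsCoord φ i p ∧ IsCoord ψ p j) ?_ fun i => ?_
  · rintro i i' j j' hi ⟨p, hp, hj⟩ ⟨p', hp', hj'⟩
    rcases (hφ.2 i i' hi p p' hp hp').lt_or_eq with h | rfl
    · exact hψ.2 p p' h j j' hj hj'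
    · exact (hj.eq hj').le
  · rcases hφ.1 i with ⟨b, hb⟩ | ⟨p, hp⟩
    · exact Or.inl ⟨b, fun v => hb _⟩
    rcases hψ.1 p with ⟨b, hb⟩ | ⟨j, hj⟩
    · refine Or.inl ?_
      rcases hp with hp | hp
      · exact ⟨b, fun v => by simp [hp, hb]⟩
      · exact ⟨!b, fun v => by simp [hp, hb]⟩
    · refine Or.inr ⟨j, ⟨p, hp, hj⟩, ?_⟩
      rcases hp with hp | hp <;> rcases hj with hj | hj
      · exact Or.inl fun v => by simp [hp, hj]
      · exact Or.inr fun v => by simp [hp, hj]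
      · exact Or.inr fun v => by simp [hp, hj]
      · exact Or.inl fun v => by simp [hp, hj]

/-- Precomposition with a monotone map of coordinates. -/
theorem isGMorphism_comp_right {n m : ℕ} (e : Fin m → Fin n) (he : Monotone e) :
    IsGMorphism (fun v : DCube n => (v ∘ e : DCube m)) :=
  isGMorphism_of_rel (fun i j => e i = j) (by rintro i i' _ _ h rfl rfl; exact he h.le)
    fun i => Or.inr ⟨e i, rfl, Or.inl fun _ => rfl⟩

theorem le_iff_imp {n : ℕ} {v w : DCube n} : v ≤ w ↔ ∀ i, v i = true → w i = true := by
  simp [Pi.le_def, Bool.le_iff_imp]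

instance {n : ℕ} (v w : DCube n) : Decidable (v ≤ w) := decidable_of_iff _ le_iff_imp.symm

/-- The extension of `u` along `e : Fin m ↪o Fin n` by the values of `a`. -/
noncomputable def extend {n m : ℕ} (e : Fin m ↪o Fin n) (a : DCube n) (u : DCube m) : DCube n :=
  Function.extend e u a

@[simp] theorem extend_apply {n m : ℕ} (e : Fin m ↪o Fin n) (a : DCube n) (u : DCube m)
    (j : Fin m) : extend e a u (e j) = u j := e.injective.extend_apply u a j

theorem extend_apply' {n m : ℕ} (e : Fin m ↪o Fin n) (a : DCube n) (u : DCube m)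
    {i : Fin n} (hi : ∀ j, e j ≠ i) : extend e a u i = a i :=
  Function.extend_apply' _ _ _ fun ⟨j, hj⟩ => hi j hj

theorem isGMorphism_extend {n m : ℕ} (e : Fin m ↪o Fin n) (a : DCube n) :
    IsGMorphism (extend e a) := by
  refine isGMorphism_of_rel (fun i j => e j = i) ?_ fun i => ?_
  · rintro _ _ j j' h rfl rfl
    exact (e.lt_iff_lt.1 h).le
  · by_cases hi : ∃ j, e j = i
    · obtain ⟨j, rfl⟩ := hi
      exact Or.inr ⟨j, rfl, Or.inl fun v => extend_apply e a v j⟩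
    · exact Or.inl ⟨a i, fun v => extend_apply' e a v fun j hj => hi ⟨j, hj⟩⟩

theorem extend_comp {n m : ℕ} (e : Fin m ↪o Fin n) (a : DCube n) (u : DCube m) :
    (extend e a u) ∘ e = u := funext fun j => extend_apply e a u j

theorem extend_mono {n m : ℕ} (e : Fin m ↪o Fin n) (a : DCube n) : Monotone (extend e a) := by
  intro u u' h i
  by_cases hi : ∃ j, e j = i
  · obtain ⟨j, rfl⟩ := hi
    simpa using h j
  · rw [extend_apply', extend_apply']
    exacts [fun j hj => hi ⟨j, hj⟩, fun j hj => hi ⟨j, hj⟩]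

theorem extend_injective {n m : ℕ} (e : Fin m ↪o Fin n) (a : DCube n) :
    Function.Injective (extend e a) := fun u u' h => by
  rw [← extend_comp e a u, h, extend_comp]

theorem extend_strictMono {n m : ℕ} (e : Fin m ↪o Fin n) (a : DCube n) :
    StrictMono (extend e a) := (extend_mono e a).strictMono_of_injective (extend_injective e a)

theorem extend_bot_comp {n m : ℕ} (e : Fin m ↪o Fin n) (w : DCube n) :
    extend e ⊥ (w ∘ e) = w ⊓ extend e ⊥ ⊤ := by
  funext i
  by_cases hi : ∃ j, e j = i
  · obtain ⟨j, rfl⟩ := hi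
    simp
  · rw [Pi.inf_apply, extend_apply', extend_apply']
    · simp
    exacts [fun j hj => hi ⟨j, hj⟩, fun j hj => hi ⟨j, hj⟩]

/-- The order embedding onto the support of a vertex. -/
def suppEmb {n : ℕ} (v : DCube n) : Fin (height v) ↪o Fin n := (supp v).orderEmbOfFin rfl

theorem mem_supp {n : ℕ} {v : DCube n} {i : Fin n} : i ∈ supp v ↔ v i = true := by
  simp [supp]

theorem exists_suppEmb {n : ℕ} {v : DCube n} {i : Fin n} :
    (∃ j, suppEmb v j = i) ↔ v i = true := by
  rw [← mem_supp]
  have := Finset.range_orderEmbOfFin (supp v) rfl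
  exact Set.ext_iff.1 this i

theorem simplicialEmb_eq {n : ℕ} (v : DCube n) : simplicialEmb v = extend (suppEmb v) ⊥ := by
  funext u i
  by_cases hi : v i = true
  · obtain ⟨j, rfl⟩ := exists_suppEmb.2 hi
    have h1 : suppEmb v j ∈ supp v := mem_supp.2 hi
    have h2 : ((supp v).orderIsoOfFin rfl).symm ⟨suppEmb v j, h1⟩ = j := by
      rw [OrderIso.symm_apply_eq]
      rfl
    simp [simplicialEmb, h1, h2]
  · have h1 : i ∉ supp v := fun h => hi (mem_supp.1 h)
    rw [extend_apply' _ _ _ fun j hj => hi (exists_suppEmb.1 ⟨j, hj⟩)]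
    simp [simplicialEmb, h1]

theorem extend_suppEmb_top {n : ℕ} (v : DCube n) : extend (suppEmb v) ⊥ ⊤ = v := by
  funext i
  by_cases hi : v i = true
  · obtain ⟨j, rfl⟩ := exists_suppEmb.2 hi
    simp [hi]
  · rw [extend_apply' _ _ _ fun j hj => hi (exists_suppEmb.1 ⟨j, hj⟩)]
    simp [hi]

theorem extend_suppEmb_comp {n : ℕ} (v w : DCube n) :
    extend (suppEmb v) ⊥ (w ∘ suppEmb v) = w ⊓ v := by
  rw [extend_bot_comp, extend_suppEmb_top]

theorem height_lt {n : ℕ} {v w : DCube n} (h : v < w) : height v < height w := by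
  refine Finset.card_lt_card ⟨fun i hi => ?_, fun hs => ?_⟩
  · rw [mem_supp] at hi ⊢
    exact le_iff_imp.1 h.le i hi
  · refine h.not_ge fun i => ?_
    by_cases hi : w i = true
    · rw [hi, mem_supp.1 (hs (mem_supp.2 hi))]
    · simp at hi
      rw [hi]
      exact bot_le

theorem height_top (n : ℕ) : height (⊤ : DCube n) = n := by
  have : supp (⊤ : DCube n) = Finset.univ := by
    ext i; simp [mem_supp]
  rw [height, this]
  simp

/-- Every vertex of height at least `k` is the top vertex of a `k`-dimensional face. -/
theorem exists_extend_top_eq {n k : ℕ} {v : DCube n} (h : k ≤ height v) :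
    ∃ e : Fin k ↪o Fin n, extend e v ⊤ = v := by
  obtain ⟨s, hs, hk⟩ := Finset.exists_subset_card_eq h
  refine ⟨s.orderEmbOfFin hk, ?_⟩
  funext i
  by_cases hi : ∃ j, s.orderEmbOfFin hk j = i
  · obtain ⟨j, rfl⟩ := hi
    have := mem_supp.1 (hs (Finset.orderEmbOfFin_mem s hk j))
    simp [this]
  · exact extend_apply' _ _ _ fun j hj => hi ⟨j, hj⟩

/-- Inversion of the coordinates in the support of `s`. -/
def reflect {n : ℕ} (s v : DCube n) : DCube n := fun i => xor (s i) (v i)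

@[simp] theorem reflect_reflect {n : ℕ} (s v : DCube n) : reflect s (reflect s v) = v := by
  funext i; simp [reflect]

theorem isGMorphism_reflect {n : ℕ} (s : DCube n) : IsGMorphism (reflect s) :=
  isGMorphism_of_coord (fun i b => xor (s i) b) fun _ _ => rfl

theorem isGMorphism_inf {n : ℕ} (s : DCube n) : IsGMorphism (fun v => v ⊓ s) :=
  isGMorphism_of_coord (fun i b => b ⊓ s i) fun _ _ => rfl

end DCube

/-! ### Simplicial extension and gluing -/

namespace CubeStructure

open DCube

variable {X : Type u} {C : CubeStructure X}

namespace IsGroupspace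

theorem mem_zero (hC : C.IsGroupspace) (c : DCube 0 → X) : c ∈ C.cubes 0 := by
  have h : (fun _ => c default : DCube 1 → X) ∈ C.cubes 1 := by rw [hC.ergodicity]; trivial
  have := hC.presheaf 0 1 (fun _ => ⊥)
    (isGMorphism_of_rel (fun _ _ => True) (fun _ _ j => j.elim0)
      fun i => Or.inl ⟨false, fun _ => rfl⟩) _ h
  convert this using 1
  funext v
  simp [Subsingleton.elim v default]

theorem mem_coord (hC : C.IsGroupspace) {n : ℕ} (f : Bool → X) (j : Fin n) :
    (fun v : DCube n => f (v j)) ∈ C.cubes n := by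
  have h : (fun v => f (v 0) : DCube 1 → X) ∈ C.cubes 1 := by rw [hC.ergodicity]; trivial
  exact hC.presheaf n 1 _ (isGMorphism_comp_right (fun _ => j) fun _ _ _ => le_rfl) _ h

theorem mem_const (hC : C.IsGroupspace) (n : ℕ) (x : X) : (fun _ => x) ∈ C.cubes n := by
  have := hC.presheaf n 0 (fun v => v ∘ Fin.elim0)
    (isGMorphism_comp_right _ fun i => i.elim0) _ (hC.mem_zero fun _ => x)
  exact this

/-- The inductive step of `exists_extension`. Each face of the corner has a largest vertex `v`, and
restricting the cube `w ↦ f (w ⊓ v)` shows that `f` is a cube on that face. -/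
theorem exists_completion (hC : C.IsGroupspace) {n m : ℕ} (e : Fin m ↪o Fin n) (f : DCube n → X)
    (h : ∀ v < extend e ⊥ ⊤, (fun w => f (w ⊓ v)) ∈ C.cubes n) :
    ∃ c ∈ C.cubes m, ∀ u ≠ ⊤, c u = f (extend e ⊥ u) := by
  obtain ⟨c, hc, hcf⟩ := hC.completion m (fun u => f (extend e ⊥ u.1)) (by
    cases m with
    | zero => trivial
    | succ m =>
      intro i
      have hlt : extend e ⊥ (face i false ⊤) < extend e ⊥ ⊤ :=
        extend_strictMono e ⊥ (lt_top_iff_ne_top.2 (face_false_ne_ones i _))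
      have h1 := hC.presheaf _ _ _ (isGMorphism_extend e ⊥) _ (h _ hlt)
      have hf : face i false = extend i.succAboveOrderEmb (face i false ⊤) := by
        funext u j
        induction j using Fin.succAboveCases i with
        | x =>
          rw [extend_apply' _ _ _ fun j hj => Fin.succAbove_ne i j hj]
          simp [face]
        | p j =>
          have := extend_apply i.succAboveOrderEmb (face i false ⊤) u j
          rw [Fin.succAboveOrderEmb_apply] at this
          rw [this]
          simp [face]
      have h2 := hC.presheaf _ _ _ (isGMorphism_extend i.succAboveOrderEmb (face i false ⊤)) _ h1
      rw [← hf] at h2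
      convert h2 using 1
      funext u
      simp only [Function.comp, puncturedFace]
      rw [inf_eq_left.2]
      refine extend_mono e ⊥ ?_
      rw [hf]
      exact extend_mono _ _ le_top)
  exact ⟨c, hc, fun u hu => hcf ⟨u, hu⟩⟩

/-- Simplicial extension: a map which is a cube below every vertex of a lower set `S` agrees on
`S` with a cube. -/
theorem exists_extension (hC : C.IsGroupspace) {n : ℕ} (S : Set (DCube n)) (hS : IsLowerSet S)
    (f : DCube n → X) (h : ∀ v ∈ S, (fun w => f (w ⊓ v)) ∈ C.cubes n) :
    ∃ c ∈ C.cubes n, ∀ v ∈ S, c v = f v := by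
  -- Fill the missing vertices one at a time; below a minimal missing vertex everything lies in `S`,
  -- so completion applies there.
  induction hk : Sᶜ.ncard using Nat.strong_induction_on generalizing S f with
  | _ k ih =>
  by_cases hT : Sᶜ.Nonempty
  swap
  · rw [Set.not_nonempty_iff_eq_empty, Set.compl_empty_iff] at hT
    subst hT
    exact ⟨f, by simpa using h ⊤ trivial, fun _ _ => rfl⟩
  obtain ⟨v, hv⟩ := (Set.toFinite Sᶜ).exists_minimal hT
  have hlt : ∀ w < v, w ∈ S := fun w hw => by
    by_contra hwS
    exact hw.not_ge (hv.2 hwS hw.le)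
  obtain ⟨c, hc, hcf⟩ := hC.exists_completion (suppEmb v) f (by
    rw [extend_suppEmb_top]
    exact fun w hw => h w (hlt w hw))
  have hvS : v ∉ S := hv.1
  set f' := Function.update f v (c ⊤) with hf'
  have hff' : ∀ w ∈ S, f' w = f w := fun w hw => by
    rw [hf', Function.update_of_ne]
    rintro rfl
    exact hvS hw
  obtain ⟨d, hd, hdf⟩ := ih (insert v S)ᶜ.ncard (by
      rw [← hk]
      refine Set.ncard_lt_ncard ?_ (Set.toFinite _)
      exact compl_lt_compl_iff_lt.2 (Set.ssubset_insert hvS)) (insert v S)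
    (by
      rintro a b hba (rfl | ha)
      · rcases hba.eq_or_lt with rfl | hlt'
        · exact Or.inl rfl
        · exact Or.inr (hlt b hlt')
      · exact Or.inr (hS hba ha)) f' (by
      rintro w (rfl | hw)
      -- Below the new vertex, the modified map is the completed cube pulled back along restriction
      -- to the support of that vertex.
      · have h1 := hC.presheaf _ _ _
          (isGMorphism_comp_right (suppEmb w) (suppEmb w).monotone) _ hc
        convert h1 using 1
        funext u
        simp only [Function.comp_apply]
        by_cases hu : u ⊓ w = w
        · have : u ∘ suppEmb w = ⊤ := by
            have h2 := extend_suppEmb_comp w u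
            rw [hu] at h2
            apply extend_injective (suppEmb w) ⊥
            rw [h2, extend_suppEmb_top]
          rw [this, hu, hf', Function.update_self]
        · rw [hcf, extend_suppEmb_comp, hff']
          · exact hlt _ (lt_of_le_of_ne inf_le_right hu)
          · intro h2
            apply hu
            rw [← extend_suppEmb_comp, h2, extend_suppEmb_top]
      · convert h w hw using 1
        funext u
        exact hff' _ (hS inf_le_right hw)) rfl
  exact ⟨d, hd, fun w hw => by rw [hdf w (Or.inr hw), hff' w hw]⟩

/-- Gluing of the `2^n` subcubes of `{-1,0,1}^n`; the arguments `a`, `b` of `F` are the indicators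
of the coordinates `1` and `-1`. -/
theorem tricube (hC : C.IsGroupspace) {n : ℕ} (F : DCube n → DCube n → X)
    (h : ∀ ε : DCube n, (fun v => F (v ⊓ ε) (v ⊓ εᶜ)) ∈ C.cubes n) :
    (fun v => F v vᶜ) ∈ C.cubes n := by
  -- The two indicator coordinates are interleaved rather than concatenated, so that the maps
  -- between `{0,1}^n` and `{0,1}^{2n}` below respect the order condition of `𝒢`.
  let ev : Fin n → Fin (2 * n) := fun i => ⟨2 * i, by omega⟩
  let od : Fin n → Fin (2 * n) := fun i => ⟨2 * i + 1, by omega⟩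
  obtain ⟨c, hc, hcf⟩ := hC.exists_extension (n := 2 * n) {w | ∀ i, w (ev i) = false ∨ w (od i) = false}
    (by
      intro a b hba ha i
      refine (ha i).imp (fun h => ?_) fun h => ?_
      · have := hba (ev i); rw [h] at this; exact le_bot_iff.1 this
      · have := hba (od i); rw [h] at this; exact le_bot_iff.1 this)
    (fun w => F (w ∘ ev) (w ∘ od)) (by
      intro w hw
      have h1 := hC.presheaf (2 * n) n
        (fun u i => if w (ev i) then u (ev i) else if w (od i) then u (od i) else false)
        (isGMorphism_of_rel (fun i j => j = ev i ∨ j = od i)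
          (by
            intro i i' j j' hi hj hj'
            simp only [ev, od] at hj hj'
            rcases hj with rfl | rfl <;> rcases hj' with rfl | rfl <;>
              simp only [Fin.mk_le_mk] <;> rw [Fin.lt_def] at hi <;> omega)
          (by
            intro i
            by_cases h1 : w (ev i) = true
            · exact Or.inr ⟨ev i, Or.inl rfl, Or.inl fun v => by simp [h1]⟩
            by_cases h2 : w (od i) = true
            · exact Or.inr ⟨od i, Or.inr rfl, Or.inl fun v => by simp [h1, h2]⟩
            exact Or.inl ⟨false, fun v => by simp [h1, h2]⟩)) _ (h (w ∘ ev))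
      convert h1 using 1
      funext u
      simp only [Function.comp_def]
      congr 1 <;> funext i <;> have := hw i <;>
        cases h1 : w (ev i) <;> cases h2 : w (od i) <;> simp_all)
  -- Pull back along `v ↦ (v_0, 1 - v_0, v_1, 1 - v_1, …)`, whose image lies in the lower set where
  -- `c` is known.
  have h1 := hC.presheaf n (2 * n)
    (fun v i => if (i : ℕ) % 2 = 0 then v ⟨i / 2, by omega⟩ else !(v ⟨i / 2, by omega⟩))
    (isGMorphism_of_rel (fun i j => (i : ℕ) / 2 = j)
      (by intro i i' j j' hi hj hj'; rw [Fin.le_def, ← hj, ← hj']; rw [Fin.lt_def] at hi; omega)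
      (by
        intro i
        refine Or.inr ⟨⟨i / 2, by omega⟩, rfl, ?_⟩
        by_cases hi : (i : ℕ) % 2 = 0
        · exact Or.inl fun v => by simp [hi]
        · exact Or.inr fun v => by simp [hi])) _ hc
  convert h1 using 1
  funext v
  have hod : ∀ i : ℕ, (2 * i + 1) / 2 = i := fun i => by omega
  rw [Function.comp_apply, hcf]
  · congr 1 <;> funext i
    · simp [ev]
    · simp [od, Nat.add_mod, hod]
  · intro i
    cases hvi : v i <;> simp [ev, od, Nat.add_mod, hod, hvi]

/-- Modification of a cube on the face of the vertices above `m`. -/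
theorem glue (hC : C.IsGroupspace) {n : ℕ} {Q R : DCube n → X} (hQ : Q ∈ C.cubes n)
    (hR : R ∈ C.cubes n) (m : DCube n) (h : ∀ v, ¬ m ≤ v → R v = Q (v ⊔ m)) :
    (fun v => if m ≤ v then R v else Q v) ∈ C.cubes n := by
  -- At `a = v`, `b = vᶜ` this choice of `F` is the desired map. On the subcube of `ε` the argument
  -- `bᶜ` becomes `vᶜ ⊔ ε`.
  have := hC.tricube (fun a b => if m ≤ a then R bᶜ else Q bᶜ) fun ε => ?_
  · simpa using this
  by_cases hε : m ≤ ε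
  -- One pullback of `R` covers both branches: where `m ≤ v` fails, the hypothesis turns its value
  -- into `Q (vᶜ ⊔ ε)`.
  · have h1 := hC.presheaf _ _ (fun v i => if m i then v i else !(v i) || ε i)
      (isGMorphism_of_coord (fun i b => if m i then b else !b || ε i) fun _ _ => rfl) _ hR
    convert h1 using 1
    funext v
    rw [Function.comp_apply]
    have hmε : ∀ i, m i = true → ε i = true := le_iff_imp.1 hε
    by_cases hv : m ≤ v
    · have hmv : ∀ i, m i = true → v i = true := le_iff_imp.1 hv
      rw [if_pos (le_inf hv hε)]
      congr 1
      funext i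
      by_cases hi : m i = true
      · simp [hi, hmε i hi, hmv i hi]
      · simp [hi]
    · rw [if_neg fun h2 => hv (le_inf_iff.1 h2).1, h]
      · congr 1
        funext i
        by_cases hi : m i = true
        · simp [hi, hmε i hi]
        · simp [hi]
      · intro h2
        apply hv
        rw [le_iff_imp] at h2 ⊢
        intro i hi
        simpa [hi] using h2 i hi
  · have h1 := hC.presheaf _ _ (fun v => vᶜ ⊔ ε)
      (isGMorphism_of_coord (fun i b => !b || ε i) fun v i => by simp) _ hQ
    convert h1 using 1
    funext v
    rw [if_neg fun h2 => hε (le_inf_iff.1 h2).2, Function.comp_apply]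
    congr 1
    simp [compl_inf]

end IsGroupspace

end CubeStructure

/-! ### The relations `∼_i` and the factors `X_i` -/

namespace DCube

theorem isLowerSet_height_le (n k : ℕ) : IsLowerSet {v : DCube n | height v ≤ k} :=
  fun _ _ hba ha => le_trans (Finset.card_le_card fun j hj => mem_supp.2
    (le_iff_imp.1 hba j (mem_supp.1 hj))) ha

end DCube

namespace CubeStructure

open DCube

variable {X : Type u} {C : CubeStructure X}

namespace IsGroupspace

/-- Gluing reflected copies of `c₁` with one copy of `c₂` puts the common value `x` of the outer
vertices everywhere except at the single outer vertex of the `c₂` copy. -/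
theorem sim_iff (hC : C.IsGroupspace) {i : ℕ} {x y : X} :
    C.Sim i x y ↔ Function.update (fun _ => x) ⊤ y ∈ C.cubes (i + 1) := by
  constructor
  · rintro ⟨c₁, h₁, c₂, h₂, rfl, rfl, h⟩
    rw [ones_eq_top]
    -- Only the subcube `ε = ⊤` ever reaches `a = ⊤`, so it is `c₂` and all the others are `c₁`.
    have := hC.tricube (fun a b => if a = ⊤ then c₂ ⊤ else c₁ (a ⊔ b)) fun ε => ?_
    · convert this using 1
      funext v
      simp [Function.update_apply]
    by_cases hε : ε = ⊤
    · subst hε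
      convert h₂ using 1
      funext v
      by_cases hv : v = ⊤
      · simp [hv]
      · simp [hv, h ⟨v, hv⟩]
    · convert h₁ using 1
      funext v
      rw [if_neg fun h2 => hε (inf_eq_top_iff.1 h2).2, ← inf_sup_left, sup_compl_eq_top,
        inf_top_eq]
  · intro h
    refine ⟨_, hC.mem_const _ x, _, h, rfl, by simp [ones_eq_top], fun v => ?_⟩
    rw [Function.update_of_ne]
    exact v.2

theorem sim_refl (hC : C.IsGroupspace) (i : ℕ) (x : X) : C.Sim i x x := by
  rw [hC.sim_iff]
  simpa using hC.mem_const _ x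

theorem _root_.CubeStructure.Sim.symm {i : ℕ} {x y : X} (h : C.Sim i x y) : C.Sim i y x := by
  obtain ⟨c₁, h₁, c₂, h₂, hx, hy, h⟩ := h
  exact ⟨c₂, h₂, c₁, h₁, hy, hx, fun v => (h v).symm⟩

/-- The constant cube `y`, changed at the top to `x` and to `z` respectively, gives two cubes that
witness the relation. -/
theorem sim_trans (hC : C.IsGroupspace) {i : ℕ} {x y z : X} (h : C.Sim i x y)
    (h' : C.Sim i y z) : C.Sim i x z := by
  refine ⟨_, hC.sim_iff.1 h.symm, _, hC.sim_iff.1 h', by simp [ones_eq_top],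
    by simp [ones_eq_top], fun v => ?_⟩
  rw [Function.update_of_ne, Function.update_of_ne] <;> exact v.2

theorem equivalence_sim (hC : C.IsGroupspace) (i : ℕ) : Equivalence (C.Sim i) :=
  ⟨hC.sim_refl i, Sim.symm, hC.sim_trans⟩

theorem proj_eq_iff (hC : C.IsGroupspace) {i : ℕ} {x y : X} :
    C.proj i x = C.proj i y ↔ C.Sim i x y :=
  ⟨fun h => (hC.equivalence_sim i).eqvGen_iff.1 (Quot.eqvGen_exact h), fun h => Quot.sound h⟩

theorem reflect_mem (hC : C.IsGroupspace) {n : ℕ} {c : DCube n → X} (hc : c ∈ C.cubes n)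
    (s : DCube n) : (fun v => c (reflect s v)) ∈ C.cubes n :=
  hC.presheaf _ _ _ (isGMorphism_reflect s) _ hc

/-- Reflect `v` to the top vertex and glue on the one-vertex modification from `sim_iff` with `m =
⊤`. -/
theorem update_mem (hC : C.IsGroupspace) {i : ℕ} {c : DCube (i + 1) → X}
    (hc : c ∈ C.cubes (i + 1)) {v : DCube (i + 1)} {y : X} (h : C.Sim i (c v) y) :
    Function.update c v y ∈ C.cubes (i + 1) := by
  have hv : reflect vᶜ ⊤ = v := by funext i; simp [reflect]
  have h1 := hC.glue (hC.reflect_mem hc vᶜ) (hC.sim_iff.1 h) ⊤ fun w hw => by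
    rw [Function.update_of_ne (by simpa using hw), sup_top_eq, hv]
  have h2 := hC.reflect_mem h1 vᶜ
  convert h2 using 1
  funext w
  have : ⊤ ≤ reflect vᶜ w ↔ w = v := by
    rw [top_le_iff]
    constructor
    · intro h3
      rw [← reflect_reflect vᶜ w, h3, hv]
    · intro h3
      rw [h3]
      funext i
      simp [reflect]
  by_cases hw : w = v
  · rw [if_pos (this.2 hw), top_le_iff.1 (this.2 hw), hw, Function.update_self]
    simp
  · rw [if_neg (mt this.1 hw), Function.update_of_ne hw, reflect_reflect]

theorem mem_of_sim_succ (hC : C.IsGroupspace) {i : ℕ} {c c' : DCube (i + 1) → X}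
    (hc : c ∈ C.cubes (i + 1)) (h : ∀ v, C.Sim i (c v) (c' v)) : c' ∈ C.cubes (i + 1) := by
  classical
  have key : ∀ s : Finset (DCube (i + 1)), (fun v => if v ∈ s then c' v else c v)
      ∈ C.cubes (i + 1) := by
    intro s
    induction s using Finset.induction_on with
    | empty => simpa using hc
    | insert a s has ih =>
      have h1 := hC.update_mem (v := a) (y := c' a) ih (by simpa [has] using h a)
      convert h1 using 1
      funext v
      by_cases hv : v = a
      · subst hv; simp
      · simp [hv]
  simpa using key Finset.univ

/-- Cubes of dimension `n` are, up to degeneracy, cubes of any larger dimension. -/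
theorem mem_iff_comp (hC : C.IsGroupspace) {n m : ℕ} (h : n ≤ m) {c : DCube n → X} :
    c ∈ C.cubes n ↔ (fun v : DCube m => c (v ∘ Fin.castLEOrderEmb h)) ∈ C.cubes m := by
  constructor
  · exact fun hc => hC.presheaf _ _ _
      (isGMorphism_comp_right _ (Fin.castLEOrderEmb h).monotone) _ hc
  · intro hc
    have := hC.presheaf _ _ _ (isGMorphism_extend (Fin.castLEOrderEmb h) ⊥) _ hc
    convert this using 1
    funext v
    simp only [Function.comp_apply]
    rw [extend_comp]

/-- In dimension at most `i + 1`, being a cube depends only on the `∼_i`-classes of the values. The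
bound is what permits vertex-by-vertex updates. -/
theorem mem_of_sim (hC : C.IsGroupspace) {n i : ℕ} (hn : n ≤ i + 1) {c c' : DCube n → X}
    (hc : c ∈ C.cubes n) (h : ∀ v, C.Sim i (c v) (c' v)) : c' ∈ C.cubes n := by
  rw [hC.mem_iff_comp hn] at hc ⊢
  exact hC.mem_of_sim_succ hc fun v => h _

theorem isStep_factor (hC : C.IsGroupspace) (i : ℕ) : (C.factor i).IsStep i := by
  rintro _ ⟨c, hc, rfl⟩ _ ⟨c', hc', rfl⟩ h
  classical
  have h0 : ∀ v : DCube (i + 1), v ≠ ⊤ → C.Sim i (c' v) (c v) := fun v hv =>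
    (hC.proj_eq_iff.1 (h ⟨v, hv⟩)).symm
  have h1 : (fun v => if v = ⊤ then c' v else c v) ∈ C.cubes (i + 1) :=
    hC.mem_of_sim_succ hc' fun v => by
      by_cases hv : v = ⊤
      · simpa [hv] using hC.sim_refl i _
      · simpa [hv] using h0 v hv
  have h2 : C.Sim i (c ⊤) (c' ⊤) := ⟨c, hc, _, h1, rfl, if_pos rfl, fun v => by
    have : v.1 ≠ ⊤ := v.2
    simp [this]⟩
  funext v
  by_cases hv : v = ⊤
  · subst hv
    exact hC.proj_eq_iff.2 h2
  · exact h ⟨v, hv⟩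

end IsGroupspace

/-- Uniqueness of completion at a vertex of large height; only the presheaf property is used. -/
theorem IsStep.eq_of_lt {k : ℕ} (hk : C.IsStep k)
    (hP : ∀ (n m : ℕ) (φ : DCube n → DCube m), IsGMorphism φ →
      ∀ c ∈ C.cubes m, c ∘ φ ∈ C.cubes n)
    {n : ℕ} {c c' : DCube n → X} (hc : ∀ φ : DCube (k + 1) → DCube n, IsGMorphism φ →
      c ∘ φ ∈ C.cubes (k + 1))
    (hc' : c' ∈ C.cubes n) {v : DCube n} (hv : k + 1 ≤ height v) (h : ∀ w < v, c w = c' w) :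
    c v = c' v := by
  obtain ⟨e, he⟩ := exists_extend_top_eq hv
  have := hk _ (hc _ (isGMorphism_extend e v)) _ (hP _ _ _ (isGMorphism_extend e v) _ hc')
    fun w => h _ (by
      conv_rhs => rw [← he]
      exact extend_strictMono e v (lt_top_iff_ne_top.2 w.2))
  have := congrFun this ⊤
  simpa [he] using this

namespace IsGroupspace

/-- Only completion needs work. Lifts are unconstrained up to height `i + 1`, and above it
uniqueness of completion in `X_i` forces the values. -/
theorem isGroupspace_factor (hC : C.IsGroupspace) (i : ℕ) : (C.factor i).IsGroupspace := by
  have hsurj : Function.Surjective (C.proj i) := Quot.mk_surjective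
  have hP : ∀ (n m : ℕ) (φ : DCube n → DCube m), IsGMorphism φ →
      ∀ c ∈ (C.factor i).cubes m, c ∘ φ ∈ (C.factor i).cubes n := by
    rintro n m φ hφ _ ⟨c, hc, rfl⟩
    exact ⟨c ∘ φ, hC.presheaf n m φ hφ c hc, rfl⟩
  have low : ∀ n ≤ i + 1, ∀ c : DCube n → X, C.proj i ∘ c ∈ (C.factor i).cubes n →
      c ∈ C.cubes n := by
    rintro n hn c ⟨c', hc', h⟩
    exact hC.mem_of_sim hn hc' fun v => hC.proj_eq_iff.1 (congrFun h v).symm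
  refine ⟨hP, ?_, ?_⟩
  · refine Set.eq_univ_of_forall fun f => ?_
    choose g hg using fun v => hsurj (f v)
    exact ⟨g, by rw [hC.ergodicity]; trivial, funext fun v => (hg v).symm⟩
  · intro n f hf
    choose g hg using fun v : Punctured n => hsurj (f v)
    classical
    obtain ⟨x⟩ : Nonempty X := by
      obtain ⟨c, -⟩ := hC.completion 0 (fun v => (v.2 (Subsingleton.elim _ _)).elim) trivial
      exact ⟨c ⊤⟩
    let f' : DCube n → C.Factor i := fun v => if h : v = ⊤ then C.proj i x else f ⟨v, h⟩
    have hf' : ∀ {v}, v ≠ ⊤ → (fun w => f' (w ⊓ v)) ∈ (C.factor i).cubes n := by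
      intro v hv
      cases n with
      | zero => exact (hv (Subsingleton.elim _ _)).elim
      | succ n =>
        obtain ⟨j, hj⟩ : ∃ j, v j = false := by
          by_contra hcon
          push Not at hcon
          exact hv (funext fun j => by simpa using hcon j)
        have h1 := hP _ _ (fun w => (w ⊓ v) ∘ j.succAbove)
          ((isGMorphism_comp_right _ (Fin.strictMono_succAbove j).monotone).comp
            (isGMorphism_inf v)) _ (hf j)
        convert h1 using 1
        funext w
        have h2 : w ⊓ v ≠ ⊤ := fun h => hv (inf_eq_top_iff.1 h).2
        simp only [f', h2, dite_false, Function.comp_apply, puncturedFace]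
        congr 2
        funext l
        induction l using Fin.succAboveCases j with
        | x => simp [face, hj]
        | p l => simp [face]
    let g' : DCube n → X := fun v => if h : v = ⊤ then x else g ⟨v, h⟩
    have hg' : ∀ v, C.proj i (g' v) = f' v := fun v => by
      simp only [g', f']
      split_ifs
      · rfl
      · exact hg _
    obtain ⟨c, hc, hcg⟩ := hC.exists_extension {v : DCube n | v ≠ ⊤ ∧ height v ≤ i + 1}
      (fun a b hba ha => ⟨ne_top_of_le_ne_top ha.1 hba, isLowerSet_height_le n _ hba ha.2⟩) g' (by
        rintro v ⟨hv, hvi⟩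
        obtain ⟨c, hc, h⟩ := hf' hv
        have h1 := low _ hvi (g' ∘ extend (suppEmb v) ⊥)
          ⟨_, hC.presheaf _ _ _ (isGMorphism_extend (suppEmb v) ⊥) _ hc, by
            funext u
            have := congrFun h (extend (suppEmb v) ⊥ u)
            simp only [Function.comp_apply] at this ⊢
            rw [← this, hg', inf_eq_left.2]
            conv_rhs => rw [← extend_suppEmb_top v]
            exact extend_mono _ _ le_top⟩
        have h2 := hC.presheaf _ _ _
          (isGMorphism_comp_right (suppEmb v) (suppEmb v).monotone) _ h1
        convert h2 using 1
        funext w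
        simp only [Function.comp_apply, extend_suppEmb_comp])
    refine ⟨C.proj i ∘ c, ⟨c, hc, rfl⟩, fun v => ?_⟩
    -- The extension was prescribed only up to height `i + 1`; at a higher vertex, agreement
    -- strictly below it propagates by uniqueness.
    have key : ∀ h, ∀ v : DCube n, height v = h → v ≠ ⊤ → C.proj i (c v) = f' v := by
      intro h
      induction h using Nat.strong_induction_on with
      | _ h ih =>
      intro v hvh hv
      by_cases hvi : height v ≤ i + 1
      · rw [hcg v ⟨hv, hvi⟩, hg']
      · have := (hC.isStep_factor i).eq_of_lt hP
          (c := fun w => C.proj i (c w)) (c' := fun w => f' (w ⊓ v)) (v := v)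
          (fun φ hφ => hP _ _ φ hφ _ ⟨c, hc, rfl⟩) (hf' hv) (by omega) fun w hw => by
            rw [inf_eq_left.2 hw.le]
            exact ih _ (hvh ▸ height_lt hw) w rfl (ne_top_of_lt hw)
        simpa using this
    have hv : v.1 ≠ ⊤ := v.2
    rw [Function.comp_apply, key _ v.1 rfl hv]
    simp [f', hv]

theorem eq_of_lt (hC : C.IsGroupspace) {k : ℕ} (hk : C.IsStep k) {n : ℕ} {c c' : DCube n → X}
    (hc : c ∈ C.cubes n) (hc' : c' ∈ C.cubes n) {v : DCube n} (hv : k + 1 ≤ height v)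
    (h : ∀ w < v, c w = c' w) : c v = c' v :=
  hk.eq_of_lt hC.presheaf (fun φ hφ => hC.presheaf _ _ φ hφ _ hc) hc' hv h

/-- If the values of a cube below a vertex of height at least `k + 1` are in one `∼_k`-class, so is
the value at the vertex. -/
theorem sim_of_lt (hC : C.IsGroupspace) {k n : ℕ} {c : DCube n → X} (hc : c ∈ C.cubes n)
    {v : DCube n} (hv : k + 1 ≤ height v) {p : X} (h : ∀ w < v, C.Sim k (c w) p) :
    C.Sim k (c v) p :=
  hC.proj_eq_iff.1 <| (hC.isGroupspace_factor k).eq_of_lt (hC.isStep_factor k)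
    (c := C.proj k ∘ c) (c' := C.proj k ∘ fun _ => p) ⟨c, hc, rfl⟩ ⟨_, hC.mem_const n p, rfl⟩ hv
    fun w hw => hC.proj_eq_iff.2 (h w hw)

theorem mem_of_comp_mem_of_le (hC : C.IsGroupspace) {k n m : ℕ} {f : DCube n → X}
    (h : ∀ φ : DCube k → DCube n, IsGMorphism φ → f ∘ φ ∈ C.cubes k) (hm : m ≤ k)
    {φ : DCube m → DCube n} (hφ : IsGMorphism φ) : f ∘ φ ∈ C.cubes m :=
  (hC.mem_iff_comp hm).2 <| h _ <| hφ.comp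
    (isGMorphism_comp_right _ (Fin.castLEOrderEmb hm).monotone)

/-- Extension from the vertices of height at most `k`. -/
theorem exists_extension_height_le (hC : C.IsGroupspace) {n : ℕ} (k : ℕ) (f : DCube n → X)
    (h : ∀ v, height v ≤ k → f ∘ extend (suppEmb v) ⊥ ∈ C.cubes (height v)) :
    ∃ c ∈ C.cubes n, ∀ v, height v ≤ k → c v = f v := by
  refine hC.exists_extension _ (isLowerSet_height_le n k) f fun v hv => ?_
  have h2 := hC.presheaf _ _ _
    (isGMorphism_comp_right (suppEmb v) (suppEmb v).monotone) _ (h v hv)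
  convert h2 using 1
  funext w
  simp only [Function.comp_apply, extend_suppEmb_comp]

/-- In a `k`-step groupspace the cubes are determined by the `(k+1)`-dimensional ones. -/
theorem mem_of_comp_mem (hC : C.IsGroupspace) {k : ℕ} (hk : C.IsStep k) {n : ℕ} {f : DCube n → X}
    (h : ∀ φ : DCube (k + 1) → DCube n, IsGMorphism φ → f ∘ φ ∈ C.cubes (k + 1)) :
    f ∈ C.cubes n := by
  obtain ⟨c, hc, hcf⟩ := hC.exists_extension_height_le (k + 1) f fun v hv =>
    hC.mem_of_comp_mem_of_le h hv (isGMorphism_extend _ _)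
  -- From height `k + 2` on, uniqueness applies to `f` itself, because its pullbacks to dimension `k
  -- + 1` are cubes by hypothesis.
  have key : ∀ h, ∀ v : DCube n, height v = h → f v = c v := by
    intro l
    induction l using Nat.strong_induction_on with
    | _ l ih =>
    intro v hvl
    by_cases hvi : height v ≤ k + 1
    · exact (hcf v hvi).symm
    · exact hk.eq_of_lt hC.presheaf h hc (by omega) fun w hw => ih _ (hvl ▸ height_lt hw) w rfl
  rwa [funext fun v => key _ v rfl]

end IsGroupspace

end CubeStructure

/-! ### Permutations acting on parallel edges -/

namespace DCube

/-- `v` and `w` lie on the same edge in direction `j`. -/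
def SameEdge {n : ℕ} (j : Fin n) (v w : DCube n) : Prop := ∀ i, i ≠ j → v i = w i

instance {n : ℕ} (j : Fin n) (v w : DCube n) : Decidable (SameEdge j v w) := by
  unfold SameEdge; infer_instance

/-- The lower vertex of the edge in direction `j` at `1^n`. -/
def coatom {n : ℕ} (j : Fin n) : DCube n := fun i => decide (i ≠ j)

theorem coatom_le_iff {n : ℕ} {j : Fin n} {v : DCube n} : coatom j ≤ v ↔ SameEdge j v ⊤ := by
  simp [le_iff_imp, SameEdge, coatom]

theorem sup_coatom {n : ℕ} (j : Fin n) (v : DCube n) :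
    v ⊔ coatom j = if v j = true then ⊤ else coatom j := by
  funext i
  by_cases hi : i = j
  · subst hi; cases h : v i <;> simp [h]
  · cases h : v j <;> simp [coatom, hi]

theorem comp_succAbove_eq_top {n : ℕ} {j : Fin (n + 1)} {v : DCube (n + 1)} :
    v ∘ j.succAbove = ⊤ ↔ coatom j ≤ v := by
  rw [coatom_le_iff]
  constructor
  · intro h i hi
    obtain ⟨l, rfl⟩ := Fin.exists_succAbove_eq hi
    exact congrFun h l
  · exact fun h => funext fun l => h _ (Fin.succAbove_ne j l)

theorem SameEdge.eq_update {n : ℕ} {j : Fin n} {v w : DCube n} (h : SameEdge j v w) :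
    v = Function.update w j (v j) := by
  funext i
  by_cases hi : i = j
  · subst hi; simp
  · simp [hi, h i hi]

end DCube

namespace CubeStructure

open DCube

variable {X : Type u} {C : CubeStructure X}

/-- The map with values `y`, `w` at the two ends of the edge in direction `j` at `1^n`, and with
values `x`, `z` elsewhere. -/
def edgeMap {n : ℕ} (j : Fin n) (x y z w : X) (v : DCube n) : X :=
  if coatom j ≤ v then (if v j = true then w else y) else (if v j = true then z else x)

/-- The map `T` applied at both ends of the edge in direction `j` at `v₀`. -/
def applyEdge {n : ℕ} (j : Fin n) (v₀ : DCube n) (T : X → X) (Q : DCube n → X) (v : DCube n) : X :=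
  if SameEdge j v v₀ then T (Q v) else Q v

namespace IsGroupspace

variable {k n : ℕ} {j : Fin n}

theorem edgeMap_self (hC : C.IsGroupspace) (j : Fin n) (x z : X) :
    edgeMap j x x z z ∈ C.cubes n := by
  convert hC.mem_coord (fun b => if b = true then z else x) j using 1
  funext v
  simp [edgeMap]

theorem edgeMap_symm (hC : C.IsGroupspace) {x y z w : X} (h : edgeMap j x y z w ∈ C.cubes n) :
    edgeMap j z w x y ∈ C.cubes n := by
  have := hC.reflect_mem h (fun i => decide (i = j))
  convert this using 1
  funext v
  have : SameEdge j (reflect (fun i => decide (i = j)) v) ⊤ ↔ SameEdge j v ⊤ :=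
    forall₂_congr fun i hi => by simp [reflect, hi]
  simp only [edgeMap, coatom_le_iff, this]
  cases h : v j <;> simp [reflect, h]

/-- Concatenation in direction `j`: glue on the face `v_j = 1` and drop the common middle face. -/
theorem edgeMap_trans (hC : C.IsGroupspace) {x y z w s t : X}
    (h : edgeMap j x y z w ∈ C.cubes n) (h' : edgeMap j z w s t ∈ C.cubes n) :
    edgeMap j x y s t ∈ C.cubes n := by
  have hm : ∀ v : DCube n, (fun i => decide (i = j)) ≤ v ↔ v j = true := fun v => by
    simp [le_iff_imp]
  have := hC.glue h h' (fun i => decide (i = j)) fun v hv => by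
    have h1 : SameEdge j (v ⊔ fun i => decide (i = j)) ⊤ ↔ SameEdge j v ⊤ :=
      forall₂_congr fun i hi => by simp [hi]
    rw [hm] at hv
    simp [edgeMap, coatom_le_iff, h1, hv]
  convert this using 1
  funext v
  simp only [hm, edgeMap]
  by_cases hv : v j = true <;> simp [hv]

/-- After a reflection taking the edge at `v₀` to the one at `1^n`, this is `glue` with `m = coatom
j`, whose upper face is exactly that edge. -/
theorem replace_edge (hC : C.IsGroupspace) {x y z w : X} (h : edgeMap j x y z w ∈ C.cubes n)
    {Q : DCube n → X} (hQ : Q ∈ C.cubes n) (v₀ : DCube n)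
    (h0 : Q (Function.update v₀ j false) = x) (h1 : Q (Function.update v₀ j true) = z) :
    (fun v => if SameEdge j v v₀ then (if v j = true then w else y) else Q v) ∈ C.cubes n := by
  set s : DCube n := fun i => if i = j then false else !(v₀ i) with hs
  have hs0 : reflect s (coatom j) = Function.update v₀ j false := by
    funext i
    by_cases hi : i = j
    · subst hi; simp [reflect, hs, coatom]
    · simp [reflect, hs, coatom, hi]
  have hs1 : reflect s ⊤ = Function.update v₀ j true := by
    funext i
    by_cases hi : i = j
    · subst hi; simp [reflect, hs]
    · simp [reflect, hs, hi]
  have hg := hC.reflect_mem (hC.glue (hC.reflect_mem hQ s) h (coatom j) fun v hv => by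
    rw [edgeMap, if_neg hv, sup_coatom]
    split_ifs
    · rw [hs1, h1]
    · rw [hs0, h0]) s
  convert hg using 1
  funext v
  have hse : coatom j ≤ reflect s v ↔ SameEdge j v v₀ := by
    rw [coatom_le_iff]
    refine forall₂_congr fun i hi => ?_
    simp only [reflect, hs, hi, if_false]
    cases v i <;> cases v₀ i <;> simp
  have hj : reflect s v j = v j := by simp [reflect, hs]
  simp only [hse, reflect_reflect, edgeMap, hj]
  by_cases hv : SameEdge j v v₀ <;> simp [hv]

/-- Transport of the pair `(x, y)` to `z`: everything below `1^{k+2}` is already compatible. The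
face under `coatom j` is a cube because `x ∼_k y`, and the remaining ones depend on coordinate `j`
alone. -/
theorem exists_edgeMap (hC : C.IsGroupspace) {k : ℕ} (j : Fin (k + 2)) {x y : X} (h : C.Sim k x y)
    (z : X) : ∃ w, edgeMap j x y z w ∈ C.cubes (k + 2) := by
  have hcoat : (fun v => edgeMap j x y z z (v ⊓ coatom j)) ∈ C.cubes (k + 2) := by
    have h1 := hC.presheaf _ _ _ (isGMorphism_comp_right j.succAbove
      (Fin.strictMono_succAbove j).monotone) _ (hC.sim_iff.1 h)
    convert h1 using 1
    funext v
    have h2 := comp_succAbove_eq_top (j := j) (v := v)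
    by_cases hv : coatom j ≤ v
    · simp [edgeMap, hv, h2.2 hv, coatom]
    · have : v ∘ j.succAbove ≠ ⊤ := fun h => hv (h2.1 h)
      simp [edgeMap, hv, this, coatom]
  obtain ⟨c, hc, hcf⟩ := hC.exists_extension {v : DCube (k + 2) | v ≠ ⊤}
    (fun a b hba ha => ne_top_of_le_ne_top ha hba) (edgeMap j x y z z) (by
      intro v hv
      by_cases hjv : SameEdge j v ⊤
      · have : v ≤ coatom j := by
          rw [le_iff_imp]
          rintro i hi
          simp only [coatom, decide_eq_true_eq]
          rintro rfl
          apply hv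
          rw [hjv.eq_update, hi]
          simp
        have h1 := hC.presheaf _ _ _ (isGMorphism_inf v) _ hcoat
        convert h1 using 1
        funext w
        simp [inf_assoc, inf_eq_left.2 this]
      · have h1 := hC.presheaf _ _ _ (isGMorphism_inf v) _ (hC.edgeMap_self j x z)
        convert h1 using 1
        funext w
        have : ¬ coatom j ≤ w ⊓ v := fun h => hjv (coatom_le_iff.1 (h.trans inf_le_right))
        simp only [edgeMap, this, Function.comp_apply, if_false])
  refine ⟨c ⊤, ?_⟩
  convert hc using 1
  funext v
  by_cases hv : v = ⊤
  · subst hv; simp [edgeMap]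
  · rw [hcf v hv]
    simp only [edgeMap]
    split_ifs with h1 h2
    · refine (hv ?_).elim
      rw [(coatom_le_iff.1 h1).eq_update, h2]
      simp
    · rfl
    · rfl
    · rfl

end IsGroupspace

theorem IsStep.edgeMap_unique {k : ℕ} (hk : C.IsStep (k + 1)) {j : Fin (k + 2)} {x y z w w' : X}
    (h : edgeMap j x y z w ∈ C.cubes (k + 2)) (h' : edgeMap j x y z w' ∈ C.cubes (k + 2)) :
    w = w' := by
  have := congrFun (hk _ h _ h' fun v => ?_) ⊤
  · simpa [edgeMap] using this
  · simp only [edgeMap]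
    split_ifs with h1 h2
    · refine (v.2 ?_).elim
      rw [(coatom_le_iff.1 h1).eq_update, h2]
      simp [ones_eq_top]
    · rfl
    · rfl
    · rfl

/-- The group of permutations of `X` whose application to the ends of an edge in direction `j`
preserves and reflects `n`-cubes. -/
def edgeGroup (C : CubeStructure X) {n : ℕ} (j : Fin n) : Subgroup (Equiv.Perm X) where
  carrier := {T | ∀ v₀ Q, applyEdge j v₀ T Q ∈ C.cubes n ↔ Q ∈ C.cubes n}
  mul_mem' {S T} hS hT v₀ Q := by
    rw [← hT v₀ Q, ← hS v₀ (applyEdge j v₀ T Q)]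
    congr! 1
    funext v
    simp only [applyEdge]
    split_ifs <;> rfl
  one_mem' v₀ Q := by
    congr! 1
    funext v
    simp [applyEdge]
  inv_mem' {T} hT v₀ Q := by
    rw [← hT v₀ (applyEdge j v₀ (T⁻¹ : Equiv.Perm X) Q)]
    congr! 1
    funext v
    simp only [applyEdge]
    split_ifs <;> simp

namespace IsGroupspace

variable {k : ℕ} {j : Fin (k + 2)}

theorem edgeMap_of_mem_edgeGroup (hC : C.IsGroupspace) {n : ℕ} {j : Fin n} {T : Equiv.Perm X}
    (hT : T ∈ C.edgeGroup j) (x z : X) : edgeMap j x (T x) z (T z) ∈ C.cubes n := by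
  convert (hT ⊤ _).2 (hC.edgeMap_self j x z) using 1
  funext v
  simp only [edgeMap, applyEdge, coatom_le_iff, ite_self]
  split_ifs <;> rfl

/-- Take for `T` the transport of `(x, y)`, sending `z` to the `w` that completes `edgeMap j x y z
w`; transport of `(y, x)` is its inverse. -/
theorem exists_mem_edgeGroup (hC : C.IsGroupspace) (hk : C.IsStep (k + 1)) (j : Fin (k + 2))
    {x y : X} (h : C.Sim k x y) : ∃ T ∈ C.edgeGroup j, T x = y := by
  choose T hT using hC.exists_edgeMap j h
  choose S hS using hC.exists_edgeMap j h.symm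
  have inv : ∀ {x y : X} {T S : X → X},
      (∀ z, edgeMap j x y z (T z) ∈ C.cubes (k + 2)) →
      (∀ z, edgeMap j y x z (S z) ∈ C.cubes (k + 2)) → ∀ z, S (T z) = z := by
    intro x y T S hT hS z
    -- Replacing the top edge `y, T z` by `x, S (T z)` leaves `edgeMap j x x z (S (T z))`.
    refine hk.edgeMap_unique ?_ (hC.edgeMap_self j x z)
    convert hC.replace_edge (hS (T z)) (hT z) ⊤ (by simp +contextual [edgeMap, coatom_le_iff, SameEdge])
      (by simp +contextual [edgeMap, coatom_le_iff, SameEdge]) using 1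
    funext v
    simp only [edgeMap, coatom_le_iff]
    split_ifs <;> rfl
  have pres : ∀ {x y : X} {T : X → X}, (∀ z, edgeMap j x y z (T z) ∈ C.cubes (k + 2)) →
      ∀ v₀, ∀ Q ∈ C.cubes (k + 2), applyEdge j v₀ T Q ∈ C.cubes (k + 2) := by
    intro x y T hT v₀ Q hQ
    -- The ends of the edge are compared with each other by passing through `x`.
    convert hC.replace_edge (hC.edgeMap_trans (hC.edgeMap_symm (hT (Q (Function.update v₀ j false))))
      (hT (Q (Function.update v₀ j true)))) hQ v₀ rfl rfl using 1
    funext v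
    simp only [applyEdge]
    by_cases hv : SameEdge j v v₀
    · have h1 := hv.eq_update
      by_cases hj : v j = true
      · rw [hj] at h1
        simp [hv, hj, ← h1]
      · simp only [Bool.not_eq_true] at hj
        rw [hj] at h1
        simp [hv, hj, ← h1]
    · simp [hv]
  refine ⟨⟨T, S, inv hT hS, inv hS hT⟩, fun v₀ Q => ⟨fun h => ?_, pres hT v₀ Q⟩,
    hk.edgeMap_unique (hT x) ?_⟩
  · convert pres hS v₀ _ h using 1
    funext v
    simp only [applyEdge]
    split_ifs
    · exact (inv hT hS _).symm
    · rfl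
  · have h1 := hC.presheaf _ _ _ (isGMorphism_comp_right j.succAbove
      (Fin.strictMono_succAbove j).monotone) _ (hC.sim_iff.1 h)
    convert h1 using 1
    funext v
    have h2 := comp_succAbove_eq_top (j := j) (v := v)
    simp [edgeMap, Function.update_apply, h2]

theorem sim_apply (hC : C.IsGroupspace) {T : Equiv.Perm X} (hT : T ∈ C.edgeGroup j) (x : X) :
    C.Sim k x (T x) := by
  rw [hC.sim_iff]
  have h1 := hC.presheaf _ _ _ (isGMorphism_extend j.succAboveOrderEmb ⊤) _
    (hC.edgeMap_of_mem_edgeGroup hT x x)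
  convert h1 using 1
  funext v
  have h2 : coatom j ≤ extend j.succAboveOrderEmb ⊤ v ↔ v = ⊤ := by
    rw [← comp_succAbove_eq_top]
    exact iff_of_eq (congrArg (· = ⊤) (extend_comp j.succAboveOrderEmb ⊤ v))
  simp [edgeMap, Function.update_apply, h2]

theorem eq_one_of_apply_eq (hC : C.IsGroupspace) (hk : C.IsStep (k + 1)) {T : Equiv.Perm X}
    (hT : T ∈ C.edgeGroup j) {x : X} (h : T x = x) : T = 1 := by
  ext z
  have := hC.edgeMap_of_mem_edgeGroup hT x z
  rw [h] at this
  exact hk.edgeMap_unique this (hC.edgeMap_self j x z)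

/-- Edges in distinct directions at `1^{k+2}` meet only there. Applying `S` and `T` to a constant
cube in either order therefore gives cubes equal off the top, hence equal. -/
theorem commute_edgeGroup (hC : C.IsGroupspace) (hk : C.IsStep (k + 1)) {i j : Fin (k + 2)}
    (hij : i ≠ j) {S T : Equiv.Perm X} (hS : S ∈ C.edgeGroup i) (hT : T ∈ C.edgeGroup j) (x : X) :
    S (T x) = T (S x) := by
  have h0 := hC.mem_const (k + 2) x
  have := congrFun (hk _ ((hS ⊤ _).2 ((hT ⊤ _).2 h0)) _ ((hT ⊤ _).2 ((hS ⊤ _).2 h0)) ?_) ⊤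
  · simpa [applyEdge, SameEdge] using this
  · rintro ⟨v, hv⟩
    have : ¬ (SameEdge i v ⊤ ∧ SameEdge j v ⊤) := fun ⟨h1, h2⟩ => hv <| funext fun l => by
      by_cases hl : l = i
      · exact h2 l (hl ▸ hij)
      · exact h1 l hl
    simp only [applyEdge]
    split_ifs <;> first | rfl | tauto

/-- The edges in direction `j` partition the vertices of a `(k+2)`-cube, so `T` can be applied one
edge at a time; these cubes determine the rest. -/
theorem isMorphism_of_mem_edgeGroup (hC : C.IsGroupspace) (hk : C.IsStep (k + 1))
    {T : Equiv.Perm X} (hT : T ∈ C.edgeGroup j) : C.IsMorphism C T := by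
  intro n c hc
  refine hC.mem_of_comp_mem hk fun φ hφ => ?_
  set Q := c ∘ φ
  have hQ : Q ∈ C.cubes (k + 2) := hC.presheaf _ _ φ hφ c hc
  have key : ∀ s : Finset (DCube (k + 2)),
      -- Edges are indexed by their lower ends; vertices `a` with `a j = true` index no edge and
      -- change nothing.
      (fun v => if Function.update v j false ∈ s then T (Q v) else Q v) ∈ C.cubes (k + 2) := by
    intro s
    induction s using Finset.induction_on with
    | empty => simpa using hQ
    | insert a s has ih =>
      by_cases ha : a j = false
      · convert (hT a _).2 ih using 1
        funext v
        have h1 : SameEdge j v a ↔ Function.update v j false = a := by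
          constructor
          · intro h
            rw [h.eq_update, Function.update_idem, ← ha, Function.update_eq_self]
          · rintro rfl l hl
            simp [hl]
        by_cases hv : Function.update v j false = a
        · simp [applyEdge, h1, hv, has]
        · simp [applyEdge, h1, hv]
      · convert ih using 1
        funext v
        have : Function.update v j false ≠ a := by
          rintro rfl
          simp at ha
        simp [this]
  have := key Finset.univ
  simp only [Finset.mem_univ, if_true] at this
  exact this

theorem isIsomorphism_of_mem_edgeGroup (hC : C.IsGroupspace) (hk : C.IsStep (k + 1))
    {T : Equiv.Perm X} (hT : T ∈ C.edgeGroup j) : C.IsIsomorphism C T :=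
  ⟨hC.isMorphism_of_mem_edgeGroup hk hT,
    hC.isMorphism_of_mem_edgeGroup hk ((C.edgeGroup j).inv_mem hT)⟩

/-- Let `T` agree with `S` at `x`, and move `x` to `y` by some `R` in a third direction. `R`
commutes with both, so they agree at `y`. The agreement is claimed only on one class, which is why
charts are taken class by class. -/
theorem exists_edgeGroup_apply_eq (hC : C.IsGroupspace) {k : ℕ} (hk : C.IsStep (k + 2))
    {i j : Fin (k + 3)} {S : Equiv.Perm X} (hS : S ∈ C.edgeGroup i) (x : X) :
    ∃ T ∈ C.edgeGroup j, ∀ y, C.Sim (k + 1) x y → S y = T y := by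
  by_cases hij : i = j
  · subst hij
    exact ⟨S, hS, fun _ _ => rfl⟩
  obtain ⟨T, hT, hTx⟩ := hC.exists_mem_edgeGroup hk j (hC.sim_apply hS x)
  refine ⟨T, hT, fun y hy => ?_⟩
  obtain ⟨l, hl⟩ : ∃ l, l ∉ ({i, j} : Finset (Fin (k + 3))) := by
    by_contra! h
    have h1 := Finset.card_le_card (fun l _ => h l : Finset.univ ⊆ {i, j})
    have h2 := Finset.card_le_two (a := i) (b := j)
    simp at h1
    omega
  simp only [Finset.mem_insert, Finset.mem_singleton, not_or] at hl
  obtain ⟨R, hR, rfl⟩ := hC.exists_mem_edgeGroup hk l hy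
  rw [← hC.commute_edgeGroup hk hl.1 hR hS, ← hC.commute_edgeGroup hk hl.2 hR hT, hTx]

/-- On the class of `x`, replace `T` by an element of another direction, which commutes with `S`. -/
theorem edgeGroup_comm (hC : C.IsGroupspace) {k : ℕ} (hk : C.IsStep (k + 2)) {j : Fin (k + 3)}
    {S T : Equiv.Perm X} (hS : S ∈ C.edgeGroup j) (hT : T ∈ C.edgeGroup j) : S * T = T * S := by
  ext x
  obtain ⟨i, hij⟩ := exists_ne j
  obtain ⟨R, hR, hTR⟩ := hC.exists_edgeGroup_apply_eq hk (j := i) hT x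
  simp only [Equiv.Perm.mul_apply]
  rw [hTR x (hC.sim_refl _ x), hTR (S x) (hC.sim_apply hS x), hC.commute_edgeGroup hk hij hR hS]

end IsGroupspace

end CubeStructure

/-! ### Alternating sums -/

namespace DCube

variable {A : Type*} [AddCommGroup A]

theorem height_update_true {n : ℕ} {v : DCube n} {j : Fin n} (h : v j = false) :
    height (Function.update v j true) = height v + 1 := by
  have : supp (Function.update v j true) = insert j (supp v) := by
    ext i
    by_cases hi : i = j
    · subst hi; simp [mem_supp]
    · simp [mem_supp, hi]
  rw [height, this, Finset.card_insert_of_notMem]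
  simp [mem_supp, h]

theorem height_cons {n : ℕ} (b : Bool) (v : DCube n) :
    height (Fin.cons b v : DCube (n + 1)) = height v + if b = true then 1 else 0 := by
  simp only [height, supp, Finset.card_filter, Fin.sum_univ_succ]
  simp [add_comm]

theorem altSum_single {n : ℕ} (v : DCube n) (a : A) :
    altSum (Pi.single v a) = ((-1 : ℤ) ^ height v) • a := by
  rw [altSum, Finset.sum_eq_single v]
  · simp
  · intro w _ hw
    simp [hw]
  · simp

theorem altSum_add {n : ℕ} (f g : DCube n → A) : altSum (f + g) = altSum f + altSum g := by
  simp [altSum, Finset.sum_add_distrib]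

theorem altSum_sub {n : ℕ} (f g : DCube n → A) : altSum (f - g) = altSum f - altSum g := by
  simp [altSum, Finset.sum_sub_distrib, smul_sub]

theorem altSum_succ {n : ℕ} (f : DCube (n + 1) → A) :
    altSum f = altSum (fun v => f (Fin.cons false v)) - altSum (fun v => f (Fin.cons true v)) := by
  simp only [altSum]
  rw [← (Fin.consEquiv fun _ : Fin (n + 1) => Bool).sum_comp, Fintype.sum_prod_type]
  have h : ∀ b (v : DCube n), (Fin.consEquiv fun _ : Fin (n + 1) => Bool) (b, v) = Fin.cons b v :=
    fun _ _ => rfl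
  simp only [Fintype.sum_bool, h, height_cons]
  simp [add_comm, sub_eq_add_neg, pow_succ]

theorem altSum_const {n : ℕ} (a : A) : altSum (fun _ : DCube (n + 1) => a) = 0 := by
  rw [altSum_succ, sub_self]

theorem eq_of_altSum_eq {n : ℕ} {f g : DCube n → A} (h : altSum f = altSum g)
    (hfg : ∀ v ≠ ⊤, f v = g v) : f ⊤ = g ⊤ := by
  have h1 : f - g = Pi.single ⊤ (f ⊤ - g ⊤) := by
    funext v
    by_cases hv : v = ⊤
    · subst hv; simp
    · simp [hv, hfg v hv]
  have h2 := altSum_single (⊤ : DCube n) (f ⊤ - g ⊤)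
  rw [← h1, altSum_sub, h, sub_self] at h2
  rcases neg_one_pow_eq_or ℤ (height (⊤ : DCube n)) with h3 | h3 <;> rw [h3] at h2 <;>
    simpa [sub_eq_zero, eq_comm (a := (0 : A)), eq_comm (a := g ⊤)] using h2

end DCube

/-! ### Charts of classes, and fibers -/

namespace CubeStructure

open DCube

variable {X : Type u} {C : CubeStructure X}

/-- A parametrization of the `∼_k`-class of `t 0` by an abelian group whose translations can be
applied to the edges of the `(k+2)`-cubes. -/
structure IsClassChart (C : CubeStructure X) (k : ℕ) {A : Type*} [AddCommGroup A] (t : A → X) :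
    Prop where
  injective : Function.Injective t
  sim_iff : ∀ x, C.Sim k x (t 0) ↔ ∃ a, t a = x
  edge : ∀ (j : Fin (k + 2)) (v₀ : DCube (k + 2)) (b : A) (a : DCube (k + 2) → A),
    (fun v => t ((if SameEdge j v v₀ then b else 0) + a v)) ∈ C.cubes (k + 2) ↔
      (fun v => t (a v)) ∈ C.cubes (k + 2)

namespace IsClassChart

variable {A : Type*} [AddCommGroup A] {k : ℕ} {t : A → X}

/-- The functions whose addition does not affect being a cube. -/
def invariants (C : CubeStructure X) (n : ℕ) (t : A → X) : AddSubgroup (DCube n → A) where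
  carrier := {b | ∀ a : DCube n → A, (fun v => t (b v + a v)) ∈ C.cubes n ↔ (fun v => t (a v)) ∈ C.cubes n}
  add_mem' {b c} hb hc a := by
    rw [← hc a, ← hb fun v => c v + a v]
    simp [add_assoc]
  zero_mem' := by simp
  neg_mem' {b} hb a := by
    rw [← hb fun v => (-b) v + a v]
    simp

/-- Adding `b` at both ends of an edge is invariant, so `b` at the lower end may be traded for `-b`
at the upper end. Climbing to `⊤` takes `k + 2 - height v` edges, whence the sign. -/
theorem single_sub_mem_invariants (ht : C.IsClassChart k t) (v : DCube (k + 2)) (b : A) :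
    (Pi.single v b - Pi.single ⊤ (((-1 : ℤ) ^ (k + 2 + height v)) • b) : DCube (k + 2) → A) ∈
      invariants C (k + 2) t := by
  induction v using WellFoundedGT.induction with
  | _ v ih =>
  by_cases hv : v = ⊤
  · subst hv
    rw [height_top, ← two_mul]
    simp
  obtain ⟨j, hj⟩ : ∃ j, v j = false := by
    by_contra hcon
    push Not at hcon
    exact hv (funext fun j => by simpa using hcon j)
  have hlt : v < Function.update v j true := by
    refine lt_of_le_of_ne (le_iff_imp.2 fun i hi => ?_) fun h => ?_
    · by_cases hij : i = j
      · subst hij; simp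
      · simp [hij, hi]
    · have := congrFun h j
      simp [hj] at this
  have h1 := ih _ hlt
  have h2 : (fun w => if SameEdge j w v then b else 0) ∈ invariants C (k + 2) t := ht.edge j v b
  convert sub_mem h2 h1 using 1
  have h3 : (fun w => if SameEdge j w v then b else 0) =
      Pi.single v b + Pi.single (Function.update v j true) b := by
    funext w
    by_cases hw : SameEdge j w v
    · have h4 := hw.eq_update
      by_cases hwj : w j = true
      · rw [hwj] at h4
        have : w ≠ v := by rintro rfl; simp [hj] at hwj
        rw [if_pos hw, Pi.add_apply, Pi.single_eq_of_ne this, h4, Pi.single_eq_same, zero_add]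
      · simp only [Bool.not_eq_true] at hwj
        rw [hwj, ← hj, Function.update_eq_self] at h4
        subst h4
        rw [if_pos hw, Pi.add_apply, Pi.single_eq_same, Pi.single_eq_of_ne hlt.ne, add_zero]
    · have h4 : w ≠ v := by rintro rfl; exact hw fun _ _ => rfl
      have h5 : w ≠ Function.update v j true := by
        rintro rfl
        exact hw fun i hi => by simp [hi]
      simp [hw, h4, h5]
  rw [h3, height_update_true hj, ← add_assoc, pow_succ]
  simp only [mul_neg, mul_one, neg_smul, Pi.single_neg]
  abel

/-- Collect all values at `⊤`: what remains is zero elsewhere and `± altSum a` there. By uniqueness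
it is a cube only if it is constant. -/
theorem mem_iff_altSum (hC : C.IsGroupspace) (hk : C.IsStep (k + 1)) (ht : C.IsClassChart k t)
    (a : DCube (k + 2) → A) : (fun v => t (a v)) ∈ C.cubes (k + 2) ↔ altSum a = 0 := by
  have h1 : a - Pi.single ⊤ (((-1 : ℤ) ^ (k + 2)) • altSum a) ∈ invariants C (k + 2) t := by
    have := sum_mem (t := Finset.univ) fun v (_ : v ∈ Finset.univ) =>
      ht.single_sub_mem_invariants v (a v)
    convert this using 1
    rw [Finset.sum_sub_distrib, Finset.univ_sum_single]
    congr 1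
    rw [altSum, Finset.smul_sum]
    simp only [smul_smul, ← pow_add]
    exact map_sum (AddMonoidHom.single (fun _ : DCube (k + 2) => A) ⊤) _ _
  have h2 := h1 (Pi.single ⊤ (((-1 : ℤ) ^ (k + 2)) • altSum a))
  simp only [Pi.sub_apply, sub_add_cancel] at h2
  rw [h2]
  constructor
  · intro h
    have h3 := congrFun (hk _ h _ (hC.mem_const _ (t 0)) fun v => by
      have : v.1 ≠ ⊤ := v.2
      simp [this]) ⊤
    have h4 := ht.injective h3
    rw [Pi.single_eq_same] at h4
    rcases neg_one_pow_eq_or ℤ (k + 2) with h5 | h5 <;> rw [h5] at h4 <;> simpa using h4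
  · intro h
    rw [h, smul_zero]
    simpa using hC.mem_const _ (t 0)

theorem sim_apply (ht : C.IsClassChart k t) (a : A) : C.Sim k (t a) (t 0) :=
  (ht.sim_iff _).2 ⟨a, rfl⟩

/-- The alternating sum is the difference of those of two opposite faces, so dimension `k + 2`
suffices. -/
theorem altSum_eq_zero (hC : C.IsGroupspace) (hk : C.IsStep (k + 1)) (ht : C.IsClassChart k t)
    {n : ℕ} (hn : k + 2 ≤ n) {a : DCube n → A} (ha : (fun v => t (a v)) ∈ C.cubes n) :
    altSum a = 0 := by
  induction n, hn using Nat.le_induction with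
  | base => exact (ht.mem_iff_altSum hC hk a).1 ha
  | succ n _ ih =>
    have h : ∀ b : Bool, altSum (fun v : DCube n => a (Fin.cons b v)) = 0 := fun b => ih <| by
      have h1 := hC.presheaf _ _ _ (isGMorphism_extend (Fin.succOrderEmb n) fun _ => b) _ ha
      convert h1 using 1
      funext v
      simp only [Function.comp_apply]
      congr 2
      funext i
      cases i using Fin.cases with
      | zero =>
        rw [extend_apply' _ _ _ fun j => by simp]
        simp
      | succ i =>
        have := extend_apply (Fin.succOrderEmb n) (fun _ => b) v i
        rw [Fin.coe_succOrderEmb] at this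
        rw [this]
        simp
    rw [altSum_succ, h, h, sub_zero]

theorem mem_of_le (hC : C.IsGroupspace) (hk : C.IsStep (k + 1)) (ht : C.IsClassChart k t) {n : ℕ}
    (hn : n ≤ k + 2) {a : DCube n → A} (ha : k + 2 ≤ n → altSum a = 0) :
    (fun v => t (a v)) ∈ C.cubes n := by
  rcases hn.lt_or_eq with h | rfl
  · exact hC.mem_of_sim (by omega) (hC.mem_const n (t 0)) fun v => (ht.sim_apply _).symm
  · exact (ht.mem_iff_altSum hC hk a).2 (ha le_rfl)

theorem mem_iff {A : Type u} [AddCommGroup A] {t : A → X} (hC : C.IsGroupspace)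
    (hk : C.IsStep (k + 1)) (ht : C.IsClassChart k t) {n : ℕ} (a : DCube n → A) :
    (fun v => t (a v)) ∈ C.cubes n ↔ a ∈ (abelianCubes (k + 1) A).cubes n := by
  constructor
  · intro ha v hv
    rw [simplicialEmb_eq]
    exact ht.altSum_eq_zero hC hk hv (hC.presheaf _ _ _ (isGMorphism_extend (suppEmb v) ⊥) _ ha)
  · intro ha
    obtain ⟨c, hc, hca⟩ := hC.exists_extension_height_le (k + 2) (fun v => t (a v)) fun v hv =>
      ht.mem_of_le hC hk hv (a := a ∘ extend (suppEmb v) ⊥) fun h => by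
        rw [← simplicialEmb_eq]
        exact ha v h
    -- The extension stays in the class, so it has coordinates `b`; these match `a` above height `k
    -- + 2` since the alternating sums determine the top value.
    have hsim : ∀ v, C.Sim k (c v) (t 0) := by
      intro v
      induction v using WellFoundedLT.induction with
      | _ v ih =>
      by_cases hv : height v ≤ k + 2
      · rw [hca v hv]
        exact ht.sim_apply _
      · exact hC.sim_of_lt hc (by omega) ih
    choose b hb using fun v => (ht.sim_iff _).1 (hsim v)
    obtain rfl : (fun v => t (b v)) = c := funext hb
    have hab : ∀ v, b v = a v := by
      intro v
      induction v using WellFoundedLT.induction with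
      | _ v ih =>
      by_cases hv : height v ≤ k + 2
      · exact ht.injective (hca v hv)
      · have h1 := ht.altSum_eq_zero hC hk (by omega)
          (hC.presheaf _ _ _ (isGMorphism_extend (suppEmb v) ⊥) _ hc)
        have h2 := ha v (by omega)
        rw [simplicialEmb_eq] at h2
        have h3 := eq_of_altSum_eq (f := b ∘ extend (suppEmb v) ⊥) (g := a ∘ extend (suppEmb v) ⊥)
          (h1.trans h2.symm) fun w hw => ih _ (by
            conv_rhs => rw [← extend_suppEmb_top v]
            exact extend_strictMono _ _ (lt_top_iff_ne_top.2 hw))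
        simpa [extend_suppEmb_top] using h3
    rwa [funext hab] at hc

end IsClassChart

namespace IsGroupspace

/-- In dimension at most `k + 1` any completion works; beyond that, completion in `X` cannot leave
the class, by `sim_of_lt`. -/
theorem isGroupspace_fiber (hC : C.IsGroupspace) {k : ℕ} (x : X) :
    (C.fiber (k + 1) x).IsGroupspace := by
  refine ⟨fun n m φ hφ c hc => hC.presheaf n m φ hφ _ hc, Set.eq_univ_of_forall fun f => ?_, ?_⟩
  · show (fun v => (f v : X)) ∈ C.cubes 1
    rw [hC.ergodicity]
    trivial
  · intro n f hf
    by_cases hn : n ≤ k + 1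
    · refine ⟨fun v => if h : v = ⊤ then ⟨x, hC.sim_refl _ x⟩ else f ⟨v, h⟩, ?_, fun v => ?_⟩
      · exact hC.mem_of_sim hn (hC.mem_const n x) fun v => Sim.symm (Subtype.prop (p := (· ∈ C.simClass k x)) _)
      · have : v.1 ≠ ⊤ := v.2
        simp [this]
    · obtain ⟨c, hc, hcf⟩ := hC.completion n (fun v => (f v : X)) (by
        cases n with
        | zero => trivial
        | succ n => exact fun i => hf i)
      have hsim : ∀ v, C.Sim k (c v) x := by
        have h1 : ∀ v ≠ ⊤, C.Sim k (c v) x := fun v hv => by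
          rw [hcf ⟨v, hv⟩]
          exact (f _).2
        intro v
        by_cases hv : v = ⊤
        · subst hv
          exact hC.sim_of_lt hc (by rw [height_top]; omega) fun w hw => h1 w hw.ne
        · exact h1 v hv
      exact ⟨fun v => ⟨c v, hsim v⟩, hc, fun v => Subtype.ext (hcf v)⟩

theorem isErgodic_fiber (hC : C.IsGroupspace) {k : ℕ} (x : X) :
    (C.fiber (k + 1) x).IsErgodic (k + 1) :=
  Set.eq_univ_of_forall fun f => hC.mem_of_sim le_rfl (hC.mem_const _ x) fun v => (f v).2.symm

theorem isStep_fiber {k : ℕ} (hk : C.IsStep (k + 1)) (x : X) :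
    (C.fiber (k + 1) x).IsStep (k + 1) := fun c hc c' hc' h => by
  have := hk _ hc _ hc' fun v => congrArg Subtype.val (h v)
  exact funext fun v => Subtype.ext (congrFun this v)

end IsGroupspace

end CubeStructure

/-! ### Structure groups of step at least two -/

namespace CubeStructure

open DCube

variable {X : Type u} {C : CubeStructure X}

theorem IsClassChart.exists_equiv {A : Type u} [AddCommGroup A] {k : ℕ} {t : A → X}
    (hC : C.IsGroupspace) (hk : C.IsStep (k + 1)) (ht : C.IsClassChart k t) {p : X}
    (hp : t 0 = p) :
    ∃ e : C.simClass k p ≃ A, (∀ a q, e q = a ↔ (q : X) = t a) ∧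
      (C.fiber (k + 1) p).IsIsomorphism (abelianCubes (k + 1) A) e := by
  subst hp
  choose g hg using fun q : C.simClass k (t 0) => (ht.sim_iff _).1 q.2
  let e : C.simClass k (t 0) ≃ A :=
    ⟨g, fun a => ⟨t a, ht.sim_apply a⟩, fun q => Subtype.ext (hg q), fun a => ht.injective (hg _)⟩
  refine ⟨e, fun a q => ⟨fun h => ?_, fun h => ?_⟩, fun n c hc => ?_, fun n a ha => ?_⟩
  · rw [← h]
    exact (hg q).symm
  · exact ht.injective ((hg q).trans h)
  · rw [← ht.mem_iff hC hk]
    have : (fun v => t ((e ∘ c) v)) = fun v => (c v : X) := funext fun v => hg (c v)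
    rw [this]
    exact hc
  · exact (ht.mem_iff hC hk a).2 ha

/-- Apply `T` to the edge at the zero vertex of the cube equal to `p` and `q` on its two faces in
direction `0`. -/
theorem faceEquiv_spike (hC : C.IsGroupspace) {n : ℕ} {T : Equiv.Perm X}
    (hT : T ∈ C.edgeGroup (0 : Fin (n + 1))) (p q : X) :
    C.FaceEquiv (0 : Fin (n + 1)) (spike n p (T p)) (spike n q (T q)) := by
  have h0 : ∀ (b : Bool) (v : DCube n), SameEdge 0 (face 0 b v) ⊥ ↔ v = zeros n := by
    intro b v
    constructor
    · intro h
      funext i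
      simpa [face, zeros] using h i.succ (Fin.succ_ne_zero i)
    · rintro rfl i hi
      obtain ⟨l, rfl⟩ := Fin.exists_succ_eq.2 hi
      simp [face, zeros]
  refine ⟨_, (hT ⊥ _).2 (hC.mem_coord (fun b => if b = true then q else p) 0), ?_, ?_⟩ <;>
  · funext v
    simp only [Function.comp_apply, applyEdge, h0, spike]
    simp [face]

/-- The structure group of a `(k+2)`-step groupspace. -/
theorem IsGroupspace.exists_structureGroup (hC : C.IsGroupspace) {k : ℕ} (hk : C.IsStep (k + 2)) :
    ∃ (A : Type u) (_ : AddCommGroup A) (_ : MulAction (Multiplicative A) X),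
      (∀ (g : Multiplicative A) (p : X), g • p = p → g = 1) ∧
      (∀ p q : X, C.Sim (k + 1) p q ↔ ∃ g : Multiplicative A, g • p = q) ∧
      (∀ g : Multiplicative A, C.IsIsomorphism C (MulAction.toPerm g)) ∧
      (∀ p : X, C.IsClassChart (k + 1) fun a : A => Multiplicative.ofAdd a • p) ∧
      ∀ (g : Multiplicative A) (p q : X),
        C.FaceEquiv (0 : Fin (k + 3)) (spike (k + 2) p (g • p)) (spike (k + 2) q (g • q)) := by
  -- Direction `0` is the direction of `≈_1`, so the matching of actions is immediate.
  let G := C.edgeGroup (0 : Fin (k + 3))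
  let : CommGroup G :=
    { (inferInstance : Group G) with
      mul_comm := fun S T => Subtype.ext (hC.edgeGroup_comm hk S.2 T.2) }
  let act : MulAction (Multiplicative (Additive G)) X :=
    { smul := fun g x => (Additive.toMul (Multiplicative.toAdd g)).1 x
      one_smul := fun _ => rfl
      mul_smul := fun _ _ _ => rfl }
  have free : ∀ (g : Multiplicative (Additive G)) (p : X), g • p = p → g = 1 := fun g p h => by
    have h1 := hC.eq_one_of_apply_eq hk (Additive.toMul (Multiplicative.toAdd g)).2 h
    exact Subtype.ext (a1 := Additive.toMul (Multiplicative.toAdd g)) (a2 := 1) h1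
  have orbits : ∀ p q : X, C.Sim (k + 1) p q ↔ ∃ g : Multiplicative (Additive G), g • p = q := by
    intro p q
    constructor
    · intro h
      obtain ⟨T, hT, hTp⟩ := hC.exists_mem_edgeGroup hk 0 h
      exact ⟨Multiplicative.ofAdd (Additive.ofMul ⟨T, hT⟩), hTp⟩
    · rintro ⟨g, rfl⟩
      exact hC.sim_apply (Additive.toMul (Multiplicative.toAdd g)).2 p
  refine ⟨Additive G, inferInstance, act, free, orbits,
    fun g => hC.isIsomorphism_of_mem_edgeGroup hk (Additive.toMul (Multiplicative.toAdd g)).2,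
    fun p => ?_, fun g p q => faceEquiv_spike hC (Additive.toMul (Multiplicative.toAdd g)).2 p q⟩
  have h0 : Multiplicative.ofAdd (0 : Additive G) • p = p := rfl
  refine ⟨fun a b hab => ?_, fun x => ?_, fun j v₀ b a => ?_⟩
  · have h1 : Multiplicative.ofAdd (a - b) • p = p := by
      simp only [sub_eq_neg_add, ofAdd_add, mul_smul] at hab ⊢
      rw [hab, ← mul_smul, ← ofAdd_add, neg_add_cancel, h0]
    exact sub_eq_zero.1 (free _ _ h1)
  · rw [h0, ← exists_congr fun a : Additive G => Iff.rfl]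
    exact ⟨fun h => (orbits p x).1 h.symm, fun h => ((orbits p x).2 h).symm⟩
  -- A chart needs edges in every direction: on the class of `p`, the element `b` acts like some `T`
  -- of direction `j`.
  · obtain ⟨T, hT, hTb⟩ := hC.exists_edgeGroup_apply_eq hk (j := j) b.toMul.2 p
    rw [← hT v₀ fun v => Multiplicative.ofAdd (a v) • p]
    congr! 1
    funext v
    simp only [applyEdge]
    split_ifs
    · rw [ofAdd_add, mul_smul, ← hTb _ ((orbits _ _).2 ⟨_, rfl⟩)]
      rfl
    · rw [zero_add]

theorem mem_abelianCubes_succ {A : Type u} [AddCommGroup A] {k : ℕ} {a : DCube (k + 1) → A} :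
    a ∈ (abelianCubes k A).cubes (k + 1) ↔ altSum a = 0 := by
  have key : ∀ {m : ℕ} (e : Fin m ↪o Fin (k + 1)), m = k + 1 →
      altSum (a ∘ extend e ⊥) = altSum a := by
    rintro m e rfl
    have he : ⇑e = id := (e.strictMono.range_inj strictMono_id).1
      ((Finite.injective_iff_surjective.1 e.injective).range_eq.trans Set.range_id.symm)
    have : extend e ⊥ = id := funext fun v => funext fun j => by
      simpa [he] using extend_apply e ⊥ v j
    rw [this, Function.comp_id]
  have hle : ∀ v : DCube (k + 1), height v ≤ k + 1 := fun v =>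
    (Finset.card_le_univ _).trans (by simp)
  constructor
  · intro h
    have h1 := h ⊤ (height_top _).ge
    rwa [simplicialEmb_eq, key _ (height_top _)] at h1
  · intro h v hv
    rw [simplicialEmb_eq, key _ ((hle v).antisymm hv), h]

/-- An isomorphism between `𝒟_k(A)` and `𝒟_k(B)` is affine. -/
theorem nonempty_addEquiv {A B : Type u} [AddCommGroup A] [AddCommGroup B] {k : ℕ}
    (h : (abelianCubes (k + 1) A).Isomorphic (abelianCubes (k + 1) B)) : Nonempty (A ≃+ B) := by
  obtain ⟨e, he, -⟩ := h
  refine ⟨{ (e.trans (Equiv.subRight (e 0))) with map_add' := fun a b => ?_ }⟩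
  let v₁ : DCube (k + 2) := Function.update ⊥ 0 true
  let v₂ : DCube (k + 2) := Function.update ⊥ 1 true
  have hbot : height (⊥ : DCube (k + 2)) = 0 := by simp [height, supp]
  have h1 : height v₁ = 1 := by rw [height_update_true rfl, hbot]
  have h2 : height v₂ = 1 := by rw [height_update_true rfl, hbot]
  have n1 : v₁ ≠ ⊥ := fun h => by rw [h, hbot] at h1; omega
  have n2 : v₂ ≠ ⊥ := fun h => by rw [h, hbot] at h2; omega
  have n3 : v₁ ≠ v₂ := fun h => by simpa [v₁, v₂] using congrFun h 0
  -- The cube encodes the relation `(a + b) - a - b = 0` at three vertices of heights 0, 1, 1; its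
  -- image gives additivity of `e - e 0`.
  have hf : altSum (Pi.single ⊥ (a + b) + Pi.single v₁ a + Pi.single v₂ b : DCube (k + 2) → A) = 0 := by
    simp only [altSum_add, altSum_single, hbot, h1, h2]
    simp
  have h3 := mem_abelianCubes_succ.1 (he _ _ (mem_abelianCubes_succ.2 hf))
  have h4 : ⇑e ∘ (Pi.single ⊥ (a + b) + Pi.single v₁ a + Pi.single v₂ b) =
      (fun _ => e 0) + (Pi.single ⊥ (e (a + b) - e 0) + Pi.single v₁ (e a - e 0) +
        Pi.single v₂ (e b - e 0)) := by
    funext v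
    simp only [Function.comp_apply, Pi.add_apply]
    by_cases hv : v = ⊥
    · subst hv; simp [n1.symm, n2.symm]
    by_cases hv1 : v = v₁
    · subst hv1; simp [n1, n3]
    by_cases hv2 : v = v₂
    · subst hv2; simp [n2, n3.symm]
    · simp [hv, hv1, hv2]
  rw [h4] at h3
  simp only [altSum_add, altSum_single, altSum_const, hbot, h1, h2] at h3
  simp only [zero_add, pow_zero, pow_one, one_smul, neg_smul] at h3
  rw [← sub_eq_add_neg, ← sub_eq_add_neg, sub_sub, sub_eq_zero] at h3
  exact h3

end CubeStructure

-- Composition of isomorphisms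

universe w

namespace CubeStructure

open DCube

variable {X : Type u} {C : CubeStructure X}

theorem IsIsomorphism.symm {Y : Type v} {D : CubeStructure Y} {e : X ≃ Y}
    (h : C.IsIsomorphism D e) : D.IsIsomorphism C e.symm := ⟨h.2, h.1⟩

theorem IsMorphism.comp {Y : Type v} {Z : Type w} {D : CubeStructure Y} {E : CubeStructure Z}
    {f : X → Y} {g : Y → Z} (hg : D.IsMorphism E g) (hf : C.IsMorphism D f) :
    C.IsMorphism E (g ∘ f) := fun n c hc => hg n _ (hf n c hc)

theorem IsIsomorphism.trans {Y : Type v} {Z : Type w} {D : CubeStructure Y} {E : CubeStructure Z}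
    {e : X ≃ Y} {f : Y ≃ Z} (h : C.IsIsomorphism D e) (h' : D.IsIsomorphism E f) :
    C.IsIsomorphism E (e.trans f) := ⟨h'.1.comp h.1, h.2.comp h'.2⟩

theorem Isomorphic.symm {Y : Type v} {D : CubeStructure Y} (h : C.Isomorphic D) :
    D.Isomorphic C := h.imp' _ fun _ he => he.symm

theorem Isomorphic.trans {Y : Type v} {Z : Type w} {D : CubeStructure Y} {E : CubeStructure Z}
    (h : C.Isomorphic D) (h' : D.Isomorphic E) : C.Isomorphic E :=
  let ⟨_, he⟩ := h
  let ⟨_, hf⟩ := h'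
  ⟨_, he.trans hf⟩

/-! ### One-step groupspaces -/

namespace IsGroupspace

theorem sim_zero (hC : C.IsGroupspace) (x y : X) : C.Sim 0 x y := by
  rw [hC.sim_iff, hC.ergodicity]
  trivial

/-- Direction `0` commutes with direction `1`, so `T` sends `g p` to `g y⁻¹ z p`: it acts as right
multiplication. It carries the edge `y, x` to the edge `z, x y⁻¹ z`. -/
theorem square_mem (hC : C.IsGroupspace) (hk : C.IsStep 1) (x y z : C.edgeGroup (1 : Fin 2))
    (p : X) : (fun v : DCube 2 => (if v 1 = true then (if v 0 = true then x * y⁻¹ * z else z)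
      else (if v 0 = true then x else y)).1 p) ∈ C.cubes 2 := by
  obtain ⟨T, hT, hTp⟩ := hC.exists_mem_edgeGroup hk (0 : Fin 2)
    (hC.sim_zero p ((y⁻¹ * z).1 p))
  have h1 := (hT ⊤ _).2 (hC.mem_coord (n := 2) (fun b => (if b = true then x else y).1 p) 0)
  have hTg : ∀ g : C.edgeGroup (1 : Fin 2), T (g.1 p) = (g * (y⁻¹ * z)).1 p := fun g => by
    rw [hC.commute_edgeGroup hk (by decide) hT g.2, hTp]
    rfl
  convert h1 using 1
  funext v
  have h2 : SameEdge (0 : Fin 2) v ⊤ ↔ v 1 = true := by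
    simp [SameEdge, Fin.forall_fin_two]
  simp only [applyEdge, h2, hTg]
  cases v 0 <;> cases v 1 <;> simp [mul_assoc]

theorem square_eq (hC : C.IsGroupspace) (hk : C.IsStep 1) {p : X}
    {g : DCube 2 → C.edgeGroup (1 : Fin 2)} (h : (fun v => (g v).1 p) ∈ C.cubes 2) :
    g ![true, true] = g ![true, false] * (g ![false, false])⁻¹ * g ![false, true] := by
  have hv : ∀ v : DCube 2, v = ![v 0, v 1] := fun v => by
    funext i; fin_cases i <;> rfl
  have hlow : ∀ v : DCube 2, v ≠ ⊤ → (g v).1 p = (if v 1 = true then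
      (if v 0 = true then g ![true, false] * (g ![false, false])⁻¹ * g ![false, true]
        else g ![false, true])
      else (if v 0 = true then g ![true, false] else g ![false, false])).1 p := by
    intro v hne
    have h2 := hv v
    cases h0 : v 0 <;> cases h1 : v 1 <;> rw [h0, h1] at h2
    · simp [← h2]
    · simp [← h2]
    · simp [← h2]
    · refine (hne (h2.trans ?_)).elim
      funext i
      fin_cases i <;> rfl
  have h1 := congrFun (hk _ h _ (hC.square_mem hk (g ![true, false]) (g ![false, false])
    (g ![false, true]) p) fun v => hlow v.1 v.2) ![true, true]
  simp only [Matrix.cons_val_one, Matrix.cons_val_zero, if_true] at h1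
  have h2 : ((g ![true, true])⁻¹ * (g ![true, false] * (g ![false, false])⁻¹ *
      g ![false, true])).1 p = p := by
    rw [Subgroup.coe_mul, Equiv.Perm.mul_apply, ← h1]
    simp
  have h3 := hC.eq_one_of_apply_eq hk (Subtype.prop _) h2
  exact (inv_mul_eq_one.1 (Subtype.ext h3))

/-- Peel off the last coordinate: the square spanned by `v'` and the last basis vertex contributes
one factor on the right, by `square_eq`. -/
theorem eq_prod_of_mem (hC : C.IsGroupspace) (hk : C.IsStep 1) {p : X} {n : ℕ}
    {g : DCube n → C.edgeGroup (1 : Fin 2)} (h : (fun v => (g v).1 p) ∈ C.cubes n) (v : DCube n) :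
    g v = g ⊥ * (List.ofFn fun i =>
      if v i = true then (g ⊥)⁻¹ * g (Function.update ⊥ i true) else 1).prod := by
  induction n with
  | zero => simp [Subsingleton.elim v ⊥]
  | succ n ih =>
    have hbot : (Fin.snoc (α := fun _ => Bool) (⊥ : DCube n) false : DCube (n + 1)) = ⊥ := by
      funext i
      cases i using Fin.lastCases <;> simp
    have hupd : ∀ i : Fin n, (Fin.snoc (α := fun _ => Bool)
        (Function.update (⊥ : DCube n) i true) false : DCube (n + 1)) =
        Function.update ⊥ i.castSucc true := fun i => by
      rw [← hbot, Fin.snoc_update]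
    have hlast : (Fin.snoc (α := fun _ => Bool) (⊥ : DCube n) true : DCube (n + 1)) =
        Function.update ⊥ (Fin.last n) true := by
      rw [← hbot, Fin.update_snoc_last]
    have hmor : ∀ v' : DCube n, IsGMorphism (fun w : DCube 2 => (Fin.snoc (α := fun _ => Bool)
        (fun i => w 0 && v' i) (w 1) : DCube (n + 1))) := by
      intro v'
      refine isGMorphism_of_rel (fun i j => (i = Fin.last n ∧ j = 1) ∨ (i ≠ Fin.last n ∧ j = 0))
        ?_ fun i => ?_
      · rintro i i' j j' hi (⟨rfl, rfl⟩ | ⟨-, rfl⟩) hj'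
        · exact (hi.not_ge (Fin.le_last _)).elim
        · exact Fin.zero_le _
      · cases i using Fin.lastCases with
        | last => exact Or.inr ⟨1, Or.inl ⟨rfl, rfl⟩, Or.inl fun w => by simp⟩
        | cast i =>
          cases hi : v' i
          · exact Or.inl ⟨false, fun w => by simp [hi]⟩
          · exact Or.inr ⟨0, Or.inr ⟨(Fin.castSucc_lt_last i).ne, rfl⟩,
              Or.inl fun w => by simp [hi]⟩
    have hface : IsGMorphism (fun w : DCube n => (Fin.snoc (α := fun _ => Bool) w false :
        DCube (n + 1))) := by
      refine isGMorphism_of_rel (fun i j => i = j.castSucc) ?_ fun i => ?_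
      · rintro _ _ j j' hi rfl rfl
        exact (Fin.castSucc_lt_castSucc_iff.1 hi).le
      · cases i using Fin.lastCases with
        | last => exact Or.inl ⟨false, fun w => by simp⟩
        | cast i => exact Or.inr ⟨i, rfl, Or.inl fun w => by simp⟩
    obtain ⟨v', b, rfl⟩ : ∃ (v' : DCube n) (b : Bool),
        v = Fin.snoc (α := fun _ => Bool) v' b :=
      ⟨Fin.init v, v (Fin.last n), (Fin.snoc_init_self v).symm⟩
    have h1 := ih (g := fun w => g (Fin.snoc (α := fun _ => Bool) w false))
      (hC.presheaf _ _ _ hface _ h) v'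
    simp only [hbot, hupd] at h1
    rw [List.ofFn_succ', List.concat_eq_append, List.prod_append]
    simp only [Fin.snoc_castSucc, Fin.snoc_last, List.prod_singleton]
    rw [← mul_assoc, ← h1]
    cases b
    · simp
    · have h2 := hC.square_eq hk (p := p)
        (g := fun w => g (Fin.snoc (α := fun _ => Bool) (fun i => w 0 && v' i) (w 1)))
        (hC.presheaf _ _ _ (hmor v') _ h)
      have hb : (fun _ : Fin n => false) = (⊥ : DCube n) := rfl
      simp only [Matrix.cons_val_one, Matrix.cons_val_zero, Bool.true_and, Bool.false_and, hb,
        hbot, hlast] at h2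
      rw [h2]
      simp [mul_assoc]

end IsGroupspace

theorem prod_ofFn_update {G : Type*} [Monoid G] {n : ℕ} (a : Fin n → G) (i : Fin n) :
    (List.ofFn fun j => if Function.update (⊥ : DCube n) i true j = true then a j else 1).prod
      = a i := by
  induction n with
  | zero => exact i.elim0
  | succ n ih =>
    rw [List.ofFn_succ, List.prod_cons]
    cases i using Fin.cases with
    | zero => simp [List.ofFn_const]
    | succ i =>
      have := ih (fun j => a j.succ) i
      convert this using 1
      simp [Function.update_apply, (Fin.succ_ne_zero i).symm]

theorem prod_ofFn_bot {G : Type*} [Monoid G] {n : ℕ} (a : Fin n → G) :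
    (List.ofFn fun j => if (⊥ : DCube n) j = true then a j else 1).prod = 1 := by
  simp [List.ofFn_const]

namespace IsGroupspace

theorem mem_iff_groupCubes (hC : C.IsGroupspace) (hk : C.IsStep 1) (p : X) {n : ℕ}
    (g : DCube n → C.edgeGroup (1 : Fin 2)) :
    (fun v => (g v).1 p) ∈ C.cubes n ↔ g ∈ (groupCubes (C.edgeGroup (1 : Fin 2))).cubes n := by
  constructor
  · exact fun h => ⟨_, _, hC.eq_prod_of_mem hk h⟩
  · rintro ⟨a₀, a, ha⟩
    -- Values at height at most one are unconstrained and determine the whole product, so the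
    -- extended cube must be `g`.
    obtain ⟨c, hc, hcf⟩ := hC.exists_extension_height_le 1 (fun v => (g v).1 p) fun v hv =>
      hC.mem_of_sim (i := 0) hv (hC.mem_const _ p) fun _ => hC.sim_zero _ _
    choose b hb using fun v => hC.exists_mem_edgeGroup hk (1 : Fin 2) (hC.sim_zero p (c v))
    obtain rfl : (fun v => b v p) = c := funext fun v => (hb v).2
    lift b to DCube n → C.edgeGroup (1 : Fin 2) using fun v => (hb v).1
    have hinj : ∀ v, height v ≤ 1 → b v = g v := fun v hv => by
      have h1 : ((g v)⁻¹ * b v).1 p = p := by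
        rw [Subgroup.coe_mul, Equiv.Perm.mul_apply, show (b v).1 p = (g v).1 p from hcf v hv]
        simp
      exact (inv_mul_eq_one.1 (Subtype.ext (hC.eq_one_of_apply_eq hk (Subtype.prop _) h1))).symm
    have hbot : height (⊥ : DCube n) = 0 := by simp [height, supp]
    have h0 : b ⊥ = a₀ := by
      rw [hinj ⊥ (by omega), ha, prod_ofFn_bot, mul_one]
    have h1 : ∀ i, b (Function.update ⊥ i true) = a₀ * a i := fun i => by
      rw [hinj _ (by rw [height_update_true rfl, hbot]), ha, prod_ofFn_update]
    have h2 : b = g := funext fun v => by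
      rw [hC.eq_prod_of_mem hk hc v, ha v]
      simp only [h0, h1, inv_mul_cancel_left]
    rwa [h2] at hc

/-- All points are `∼_0`-related, so evaluation at a base point identifies `edgeGroup 1` with `X`.
-/
theorem exists_isIsomorphism_groupCubes (hC : C.IsGroupspace) (hk : C.IsStep 1) :
    ∃ (G : Type u) (_ : Group G) (e : X ≃ G), C.IsIsomorphism (groupCubes G) e := by
  obtain ⟨c, -⟩ := hC.completion 0 (fun v => (v.2 (Subsingleton.elim _ _)).elim) trivial
  set p := c ⊤
  choose g hg hgp using fun x => hC.exists_mem_edgeGroup hk (1 : Fin 2) (hC.sim_zero p x)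
  let e : X ≃ C.edgeGroup (1 : Fin 2) := ⟨fun x => ⟨g x, hg x⟩, fun T => T.1 p, hgp, fun T => by
    have h1 : (T⁻¹ * ⟨g (T.1 p), hg _⟩).1 p = p := by
      rw [Subgroup.coe_mul, Equiv.Perm.mul_apply, hgp]
      simp
    exact (inv_mul_eq_one.1 (Subtype.ext (hC.eq_one_of_apply_eq hk (Subtype.prop _) h1))).symm⟩
  refine ⟨_, inferInstance, e, fun n c hc => ?_, fun n a ha => (hC.mem_iff_groupCubes hk p a).2 ha⟩
  rw [← hC.mem_iff_groupCubes hk p]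
  have : (fun v => ((e ∘ c) v).1 p) = c := funext fun v => hgp (c v)
  rwa [this]

end IsGroupspace

/-! ### Uniqueness and translations of `𝒟₁(G)` -/

section groupCubes

variable {G H : Type u} [Group G] [Group H]

theorem nonempty_mulEquiv (h : (groupCubes G).Isomorphic (groupCubes H)) : Nonempty (G ≃* H) := by
  obtain ⟨e, he, -⟩ := h
  refine ⟨{ (e.trans (Equiv.mulLeft (e 1)⁻¹)) with map_mul' := fun a b => ?_ }⟩
  obtain ⟨c₀, c, hc⟩ := he 2 (fun v => (if v 0 = true then a else 1) * if v 1 = true then b else 1)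
    ⟨1, ![a, b], fun v => by simp [List.ofFn_succ]⟩
  have h00 := hc ![false, false]
  have h01 := hc ![false, true]
  have h10 := hc ![true, false]
  have h11 := hc ![true, true]
  simp [List.ofFn_succ] at h00 h01 h10 h11
  simp [h00, h01, h10, h11]

theorem isIsomorphism_mulLeft (g : G) :
    (groupCubes G).IsIsomorphism (groupCubes G) (Equiv.mulLeft g) := by
  have h : ∀ g : G, (groupCubes G).IsMorphism (groupCubes G) (Equiv.mulLeft g) := by
    rintro g n c ⟨a₀, a, ha⟩
    exact ⟨g * a₀, a, fun v => by simp [ha, mul_assoc]⟩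
  exact ⟨h g, h g⁻¹⟩

theorem isIsomorphism_mulRight (g : G) :
    (groupCubes G).IsIsomorphism (groupCubes G) (Equiv.mulRight g) := by
  have h : ∀ g : G, (groupCubes G).IsMorphism (groupCubes G) (Equiv.mulRight g) := by
    rintro g n c ⟨a₀, a, ha⟩
    -- Moving `g` to the left past the product conjugates each factor.
    refine ⟨a₀ * g, fun i => MulAut.conj g⁻¹ (a i), fun v => ?_⟩
    have h1 : (List.ofFn fun i => if v i = true then MulAut.conj g⁻¹ (a i) else 1) =
        (List.ofFn fun i => if v i = true then a i else 1).map (MulAut.conj g⁻¹) := by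
      rw [List.map_ofFn]
      congr 1
      funext i
      by_cases hi : v i = true <;> simp [hi]
    rw [h1, ← map_list_prod, MulAut.conj_apply]
    simp [ha, mul_assoc]
  exact ⟨h g, h g⁻¹⟩

end groupCubes

end CubeStructure

/-! ### Maximality of the factors and assembly of the tower -/

namespace CubeStructure

open DCube

variable {X : Type u} {C : CubeStructure X}

theorem sim_of_isStep_pushforward (r : Setoid X) {i : ℕ}
    (hr : (C.pushforward (Quotient.mk r)).IsStep i) {x y : X} (h : C.Sim i x y) : r x y := by
  obtain ⟨c₁, h₁, c₂, h₂, rfl, rfl, h⟩ := h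
  exact Quotient.exact (congrFun (hr _ ⟨c₁, h₁, rfl⟩ _ ⟨c₂, h₂, rfl⟩
    fun v => congrArg (Quotient.mk r) (h v)) (ones (i + 1)))

namespace IsGroupspace

/-- A one-vertex modification in `X_i` lifts to a cube of `X` with the same `∼_i`-classes. As `∼_i`
refines `∼_j`, its values may be corrected in dimension `j + 1`. -/
theorem sim_factor_iff (hC : C.IsGroupspace) {i j : ℕ} (hji : j ≤ i) {x y : X} :
    (C.factor i).Sim j (C.proj i x) (C.proj i y) ↔ C.Sim j x y := by
  constructor
  · rw [(hC.isGroupspace_factor i).sim_iff, hC.sim_iff]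
    rintro ⟨c, hc, h⟩
    refine hC.mem_of_sim_succ hc fun v => hC.sim_of_le hji (hC.proj_eq_iff.1 ?_)
    rw [← Function.comp_apply (f := C.proj i), ← h]
    by_cases hv : v = ⊤
    · subst hv; simp
    · simp [hv]
  · rintro ⟨c₁, h₁, c₂, h₂, rfl, rfl, h⟩
    exact ⟨_, ⟨c₁, h₁, rfl⟩, _, ⟨c₂, h₂, rfl⟩, rfl, rfl, fun v => congrArg (C.proj i) (h v)⟩

theorem factorMap_eq_iff (hC : C.IsGroupspace) {i j : ℕ} (hji : j ≤ i) (p q : C.Factor i) :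
    hC.factorMap i j hji p = hC.factorMap i j hji q ↔ (C.factor i).Sim j p q := by
  obtain ⟨x, rfl⟩ := Quot.mk_surjective p
  obtain ⟨y, rfl⟩ := Quot.mk_surjective q
  exact hC.proj_eq_iff.trans (hC.sim_factor_iff hji).symm

theorem factorMap_surjective (hC : C.IsGroupspace) {i j : ℕ} (hji : j ≤ i) :
    Function.Surjective (hC.factorMap i j hji) := by
  intro q
  obtain ⟨y, rfl⟩ := Quot.mk_surjective q
  exact ⟨C.proj i y, rfl⟩

theorem exists_equiv_factor (hC : C.IsGroupspace) {k : ℕ} (hk : C.IsStep k) :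
    ∃ e : X ≃ C.Factor k, C.IsIsomorphism (C.factor k) e ∧ ∀ x, e x = C.proj k x := by
  have hinj : Function.Injective (C.proj k) := fun x y hxy => by
    obtain ⟨c₁, h₁, c₂, h₂, rfl, rfl, h⟩ := hC.proj_eq_iff.1 hxy
    rw [hk _ h₁ _ h₂ h]
  refine ⟨Equiv.ofBijective _ ⟨hinj, Quot.mk_surjective⟩, ⟨fun n c hc => ⟨c, hc, rfl⟩, ?_⟩,
    fun x => rfl⟩
  rintro n _ ⟨c, hc, rfl⟩
  convert hc using 1
  funext v
  exact Equiv.ofBijective_symm_apply_apply _ _ _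

theorem nonempty_unique_factor_zero (hC : C.IsGroupspace) : Nonempty (Unique (C.Factor 0)) := by
  obtain ⟨c, -⟩ := hC.completion 0 (fun v => (v.2 (Subsingleton.elim _ _)).elim) trivial
  refine ⟨⟨⟨C.proj 0 (c ⊤)⟩, fun p => ?_⟩⟩
  obtain ⟨x, rfl⟩ := Quot.mk_surjective p
  exact hC.proj_eq_iff.2 (hC.sim_zero _ _)

theorem isomorphic_fiber (hC : C.IsGroupspace) {k : ℕ} (hk : C.IsStep (k + 2)) :
    ∃ (A : Type u) (_ : AddCommGroup A),
      ∀ x : X, (C.fiber (k + 2) x).Isomorphic (abelianCubes (k + 2) A) := by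
  obtain ⟨A, _, _, -, -, -, chart, -⟩ := hC.exists_structureGroup hk
  refine ⟨A, inferInstance, fun x => ?_⟩
  obtain ⟨e, -, he⟩ := (chart x).exists_equiv hC hk (one_smul _ _)
  exact ⟨e, he⟩

end IsGroupspace

end CubeStructure

theorem mainTheorem2 {X : Type u} (C : CubeStructure X) (hC : C.IsGroupspace) :
    -- The fibers of a `k`-step groupspace, `k ≥ 2`.
    (∀ k : ℕ, 2 ≤ k → C.IsStep k →
      Equivalence (C.Sim (k - 1)) ∧
      (∀ x : X, (C.fiber k x).IsGroupspace ∧ (C.fiber k x).IsStep k ∧ (C.fiber k x).IsErgodic k) ∧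
      (∀ x y : X, (C.fiber k x).Isomorphic (C.fiber k y)) ∧
      ∃ (A : Type u) (_ : AddCommGroup A),
        ∀ x : X, (C.fiber k x).Isomorphic (CubeStructure.abelianCubes k A)) ∧
    -- The factors `X_i` of an arbitrary groupspace: `X_i` is its largest `i`-step factor.
    (∀ i : ℕ,
      Equivalence (C.Sim i) ∧ (C.factor i).IsGroupspace ∧ (C.factor i).IsStep i ∧
      ∀ r : Setoid X, (C.pushforward (Quotient.mk r)).IsGroupspace →
        (C.pushforward (Quotient.mk r)).IsStep i → ∀ x y : X, C.Sim i x y → r x y) ∧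
    -- The tower starts with a point, and ends with `X` itself if `X` is `k`-step.
    Nonempty (Unique (C.Factor 0)) ∧
    (∀ k : ℕ, C.IsStep k →
      ∃ e : X ≃ C.Factor k, C.IsIsomorphism (C.factor k) e ∧ ∀ x, e x = C.proj k x) ∧
    -- The first structure group and the bundle `X_1 → X_0`.
    (∃ (G : Type u) (_ : Group G),
      (∀ (H : Type u) [Group H],
        (C.factor 1).Isomorphic (CubeStructure.groupCubes H) → Nonempty (G ≃* H)) ∧
      ∃ (_ : MulAction G (C.Factor 1)) (_ : MulAction Gᵐᵒᵖ (C.Factor 1)) (e : C.Factor 1 ≃ G),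
        (C.factor 1).IsIsomorphism (CubeStructure.groupCubes G) e ∧
        (∀ (g : G) (p : C.Factor 1), e (g • p) = g * e p) ∧
        (∀ (g : G) (p : C.Factor 1), e (MulOpposite.op g • p) = e p * g) ∧
        IsPrincipalBundle G (hC.factorMap 1 0 (Nat.zero_le 1)) ∧
        IsPrincipalBundle Gᵐᵒᵖ (hC.factorMap 1 0 (Nat.zero_le 1)) ∧
        (∀ g : G, (C.factor 1).IsIsomorphism (C.factor 1) (MulAction.toPerm g)) ∧
        (∀ g : Gᵐᵒᵖ, (C.factor 1).IsIsomorphism (C.factor 1) (MulAction.toPerm g))) ∧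
    -- The `k`-th structure group and the bundle `X_k → X_{k-1}`, `k ≥ 2`.
    (∀ k : ℕ, 2 ≤ k →
      ∃ (A : Type u) (_ : AddCommGroup A),
        (∀ p : C.Factor k, ((C.factor k).fiber k p).Isomorphic (CubeStructure.abelianCubes k A)) ∧
        (∀ (B : Type u) [AddCommGroup B] (p : C.Factor k),
          ((C.factor k).fiber k p).Isomorphic (CubeStructure.abelianCubes k B) →
            Nonempty (A ≃+ B)) ∧
        ∃ _ : MulAction (Multiplicative A) (C.Factor k),
          IsPrincipalBundle (Multiplicative A) (hC.factorMap k (k - 1) (Nat.sub_le k 1)) ∧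
          -- the fibers of the bundle are the `∼_{k-1}`-classes of `X_k`
          (∀ p q : C.Factor k, (C.factor k).Sim (k - 1) p q ↔
            hC.factorMap k (k - 1) (Nat.sub_le k 1) p =
              hC.factorMap k (k - 1) (Nat.sub_le k 1) q) ∧
          -- the group acts by groupspace automorphisms
          (∀ g : Multiplicative A,
            (C.factor k).IsIsomorphism (C.factor k) (MulAction.toPerm g)) ∧
          -- on each fiber the action is translation, in a suitable isomorphism with `𝒟_k(A)`
          (∀ p₀ : C.Factor k, ∃ e : (C.factor k).simClass (k - 1) p₀ ≃ A,
            ((C.factor k).fiber k p₀).IsIsomorphism (CubeStructure.abelianCubes k A) e ∧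
            ∀ (a : A) (p q : (C.factor k).simClass (k - 1) p₀),
              (q : C.Factor k) = Multiplicative.ofAdd a • (p : C.Factor k) ↔ e q = e p + a) ∧
          -- the actions on different fibers are matched by the relation `≈_1`
          (∀ (a : A) (p q : C.Factor k),
            (C.factor k).FaceEquiv (0 : Fin (k + 1))
              (DCube.spike k p (Multiplicative.ofAdd a • p))
              (DCube.spike k q (Multiplicative.ofAdd a • q)))) := by
  refine ⟨fun k hk2 hk => ?_, fun i => ⟨hC.equivalence_sim i, hC.isGroupspace_factor i,
    hC.isStep_factor i, fun r _ hr x y => CubeStructure.sim_of_isStep_pushforward r hr⟩,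
    hC.nonempty_unique_factor_zero, fun k hk => hC.exists_equiv_factor hk, ?_, fun k hk2 => ?_⟩
  · obtain ⟨k, rfl⟩ := Nat.exists_eq_add_of_le' hk2
    obtain ⟨A, _, hA⟩ := hC.isomorphic_fiber hk
    exact ⟨hC.equivalence_sim _, fun x => ⟨hC.isGroupspace_fiber x,
      CubeStructure.IsGroupspace.isStep_fiber hk x, hC.isErgodic_fiber x⟩,
      fun x y => (hA x).trans (hA y).symm, A, inferInstance, hA⟩
  · obtain ⟨G, _, e, he⟩ :=
      (hC.isGroupspace_factor 1).exists_isIsomorphism_groupCubes (hC.isStep_factor 1)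
    have hsub : ∀ p q, hC.factorMap 1 0 (Nat.zero_le 1) p = hC.factorMap 1 0 (Nat.zero_le 1) q :=
      fun p q => (hC.factorMap_eq_iff _ p q).2 ((hC.isGroupspace_factor 1).sim_zero p q)
    let actL : MulAction G (C.Factor 1) :=
      { smul := fun g p => e.symm (g * e p)
        one_smul := fun p => by show e.symm (1 * e p) = p; simp
        mul_smul := fun g h p => by
          show e.symm (g * h * e p) = e.symm (g * e (e.symm (h * e p)))
          simp [mul_assoc] }
    let actR : MulAction Gᵐᵒᵖ (C.Factor 1) :=
      { smul := fun g p => e.symm (e p * g.unop)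
        one_smul := fun p => by show e.symm (e p * 1) = p; simp
        mul_smul := fun g h p => by
          show e.symm (e p * (g * h).unop) = e.symm (e (e.symm (e p * h.unop)) * g.unop)
          simp [mul_assoc] }
    have hL : ∀ (g : G) (p : C.Factor 1), e (g • p) = g * e p := fun g p => e.apply_symm_apply _
    have hR : ∀ (g : Gᵐᵒᵖ) (p : C.Factor 1), e (g • p) = e p * g.unop :=
      fun g p => e.apply_symm_apply _
    refine ⟨G, inferInstance, fun H _ hH =>
      CubeStructure.nonempty_mulEquiv (CubeStructure.Isomorphic.trans ⟨_, he.symm⟩ hH),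
      actL, actR, e, he, hL, fun g p => hR _ p, ⟨hC.factorMap_surjective _, fun g p h => ?_,
        fun p q => ⟨fun _ => ⟨e q * (e p)⁻¹, ?_⟩, fun _ => hsub p q⟩⟩,
      ⟨hC.factorMap_surjective _, fun g p h => ?_,
        fun p q => ⟨fun _ => ⟨MulOpposite.op ((e p)⁻¹ * e q), ?_⟩, fun _ => hsub p q⟩⟩,
      fun g => (he.trans (CubeStructure.isIsomorphism_mulLeft g)).trans he.symm,
      fun g => (he.trans (CubeStructure.isIsomorphism_mulRight g.unop)).trans he.symm⟩
    · have := hL g p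
      rw [h] at this
      simpa using this
    · apply e.injective
      rw [hL]
      simp
    · have := hR g p
      rw [h] at this
      simpa using this
    · apply e.injective
      rw [hR]
      simp
  · obtain ⟨k, rfl⟩ := Nat.exists_eq_add_of_le' hk2
    have hF := hC.isGroupspace_factor (k + 2)
    have hFk := hC.isStep_factor (k + 2)
    obtain ⟨A, _, _, free, orbits, aut, chart, face⟩ := hF.exists_structureGroup hFk
    have he : ∀ p₀ : C.Factor (k + 2), ∃ e : (C.factor (k + 2)).simClass (k + 1) p₀ ≃ A,
        (∀ a q, e q = a ↔ (q : C.Factor (k + 2)) = Multiplicative.ofAdd a • p₀) ∧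
          ((C.factor (k + 2)).fiber (k + 2) p₀).IsIsomorphism
            (CubeStructure.abelianCubes (k + 2) A) e := fun p₀ =>
      (chart p₀).exists_equiv hF hFk (one_smul _ _)
    refine ⟨A, inferInstance, fun p => let ⟨e, he⟩ := he p; ⟨e, he.2⟩, fun B _ p hB =>
      let ⟨e, he⟩ := he p
      CubeStructure.nonempty_addEquiv (CubeStructure.Isomorphic.trans ⟨_, he.2.symm⟩ hB),
      inferInstance, ⟨hC.factorMap_surjective _, free, fun p q =>
        (hC.factorMap_eq_iff _ p q).trans (orbits p q)⟩,
      fun p q => (hC.factorMap_eq_iff _ p q).symm, aut, fun p₀ => ?_, fun a p q => face _ p q⟩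
    obtain ⟨e, h1, h2⟩ := he p₀
    refine ⟨e, h2, fun a p q => ?_⟩
    -- Both points are written as translates of `p₀`, with `e p` the coordinate of `p`.
    rw [h1, (h1 _ p).1 rfl, ← mul_smul, ← ofAdd_add, add_comm a]
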